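/- Let $n>1$ and let $(M,\varphi,\xi,\eta,g)$ be an $n$-dimensional $\alpha$-cosymplectic manifold, $\alpha\in\mathbb R$: that is, $(\varphi,\xi,\eta,g)$ is a smooth almost contact metric structure ($\varphi^2X=-X+\eta(X)\xi$, $\eta(\xi)=1$, $\eta\circ\varphi=0$, $\varphi\xi=0$, $g(\varphi X,\varphi Y)=g(X,Y)-\eta(X)\eta(Y)$, $g(X,\varphi Y)=-g(\varphi X,Y)$, $g(X,\xi)=\eta(X)$) that is normal, i.e. $$[\varphi X,\varphi Y]-\varphi[\varphi X,Y]-\varphi[X,\varphi Y]+\varphi^2[X,Y]+2\,d\eta(X,Y)\,\xi=0,$$ and that satisfies $d\eta=0$ and $d\Phi=2\alpha\,\eta\wedge\Phi$, where $\Phi(X,Y)=g(\varphi X,Y)$. Let $\nabla$ be the Levi-Civita connection, with scalar curvature $r$, and let $\operatorname{div}\xi=\operatorname{tr}(X\mapsto\nabla_X\xi)$. Let $\tilde\nabla$ be the quarter-symmetric metric connection, i.e. $\tilde\nabla g=0$ and $\tilde\nabla$ has torsion $T(X,Y)=\eta(Y)\varphi X-\eta(X)\varphi Y$. For the connection $\tilde\nabla$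 let $\tilde R(X,Y)=[\tilde\nabla_X,\tilde\nabla_Y]-\tilde\nabla_{[X,Y]}$, let $\tilde S(Y,Z)=\operatorname{tr}(X\mapsto\tilde R(X,Y)Z)$ be the Ricci tensor and $\tilde r=\operatorname{tr}_g\tilde S$ the scalar curvature, let $\tilde S^*(X,Y)=\tfrac12\operatorname{tr}(\varphi\circ\tilde R(X,\varphi Y))$ be the $*$-Ricci tensor and $\tilde r^*=\operatorname{tr}_g\tilde S^*$, and let $(\tilde{\mathcal L}_\xi g)(X,Y)=g(\tilde\nabla_X\xi,Y)+g(X,\tilde\nabla_Y\xi)$. Suppose that $g$ is a $*$-$\eta$-Ricci-Yamabe soliton with respect to $\tilde\nabla$ with constants $\rho,q,\Lambda,\mu\in\mathbb R$, in either of the following two senses: $$\tilde{\mathcal L}_\xi g+2\rho\,\tilde S^*+(2\Lambda-q\,\tilde r^*)\,g+2\mu\,\eta\otimes\eta=0,$$ or $$\tilde{\mathcal L}_\xi g+2\rho\,\tilde S+\big(2\Lambda+2\alpha^2\rho(n-2)-q\,\tilde r-q\alpha^2(n-1)^2\big)\,g+(2\mu+2\alpha^2\rho)\,\eta\otimes\eta=0.$$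 Then at every point of $M$ $$\Lambda=\frac{qr}{2}+\frac{q\alpha^2(n-1)^2}{2}-\alpha^2\rho(n-1)-\frac{\operatorname{div}\xi+\rho r}{n-1},\qquad \mu=\alpha^2\rho(n-1)+\frac{\operatorname{div}\xi+\rho r}{n-1}.$$ -/

import Mathlib

open Bundle
open scoped Manifold ContDiff

noncomputable section

namespace AlphaCosymplectic

/-! ### Exterior derivatives and brackets on a smooth manifold -/

section Forms

variable {E : Type*} [NormedAddCommGroup E] [NormedSpace ℝ E]
  {H : Type*} [TopologicalSpace H] (I : ModelWithCorners ℝ E H)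
  {M : Type*} [TopologicalSpace M] [ChartedSpace H M]

/-- The value at `x` of `dη(X, Y) = X(η(Y)) - Y(η(X)) - η([X, Y])`, for a 1-form `η` and vector
fields `X`, `Y`. -/
def extDerivOne (η : Π x : M, TangentSpace I x →L[ℝ] ℝ)
    (X Y : Π x : M, TangentSpace I x) (x : M) : ℝ :=
  mvfderiv I (fun y ↦ η y (Y y)) x (X x) - mvfderiv I (fun y ↦ η y (X y)) x (Y x)
    - η x (VectorField.mlieBracket I X Y x)

/-- The value at `x` of `dΩ(X, Y, Z)`, the cyclic sum of `X(Ω(Y, Z)) - Ω([X, Y], Z)`, for a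
2-form `Ω` and vector fields `X`, `Y`, `Z`. -/
def extDerivTwo (Ω : Π x : M, TangentSpace I x → TangentSpace I x → ℝ)
    (X Y Z : Π x : M, TangentSpace I x) (x : M) : ℝ :=
  mvfderiv I (fun y ↦ Ω y (Y y) (Z y)) x (X x)
    + mvfderiv I (fun y ↦ Ω y (Z y) (X y)) x (Y x)
    + mvfderiv I (fun y ↦ Ω y (X y) (Y y)) x (Z x)
    - Ω x (VectorField.mlieBracket I X Y x) (Z x)
    - Ω x (VectorField.mlieBracket I Y Z x) (X x)
    - Ω x (VectorField.mlieBracket I Z X x) (Y x)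

/-- The Nijenhuis torsion
`N(X, Y) = [φX, φY] - φ[φX, Y] - φ[X, φY] + φ²[X, Y] + 2dη(X, Y) ξ` of an almost contact
structure, where in the last term `2dη` follows the convention
`2dη(X, Y) = X(η(Y)) - Y(η(X)) - η([X, Y])`. -/
def nijenhuis (φ : Π x : M, TangentSpace I x →L[ℝ] TangentSpace I x)
    (ξ : Π x : M, TangentSpace I x) (η : Π x : M, TangentSpace I x →L[ℝ] ℝ)
    (X Y : Π x : M, TangentSpace I x) (x : M) : TangentSpace I x :=
  VectorField.mlieBracket I (fun y ↦ φ y (X y)) (fun y ↦ φ y (Y y)) x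
    - φ x (VectorField.mlieBracket I (fun y ↦ φ y (X y)) Y x)
    - φ x (VectorField.mlieBracket I X (fun y ↦ φ y (Y y)) x)
    + φ x (φ x (VectorField.mlieBracket I X Y x))
    + extDerivOne I η X Y x • ξ x

end Forms

/-! ### Curvature of a connection on a Riemannian manifold -/

section Curvature

variable {E : Type*} [NormedAddCommGroup E] [NormedSpace ℝ E]
  {H : Type*} [TopologicalSpace H] {I : ModelWithCorners ℝ E H}
  {M : Type*} [TopologicalSpace M] [ChartedSpace H M] [IsManifold I ∞ M]

/-- The value at `x` of `∇_X ∇_Y Z - ∇_Y ∇_X Z - ∇_[X,Y] Z`, for vector fields `X`, `Y`, `Z`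
(`cov Z y (Y y)` is `∇_Y Z` at `y`). -/
def curvatureField (cov : CovariantDerivative I E (TangentSpace I : M → Type _))
    (X Y Z : Π x : M, TangentSpace I x) (x : M) : TangentSpace I x :=
  cov (fun y ↦ cov Z y (Y y)) x (X x) - cov (fun y ↦ cov Z y (X y)) x (Y x)
    - cov Z x (VectorField.mlieBracket I X Y x)

/-- The curvature tensor `R(u, v)w` of a connection at `x`: the value at `x` of
`∇_X ∇_Y Z - ∇_Y ∇_X Z - ∇_[X,Y] Z` for vector fields `X`, `Y`, `Z`, smooth near `x`, that extend
the tangent vectors `u`, `v`, `w`. -/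
def curvature (cov : CovariantDerivative I E (TangentSpace I : M → Type _)) (x : M)
    (u v w : TangentSpace I x) : TangentSpace I x :=
  curvatureField cov (FiberBundle.extend E u) (FiberBundle.extend E v)
    (FiberBundle.extend E w) x

/-- The divergence of a vector field with respect to a connection: the trace of `u ↦ ∇_u V`. -/
def divergence (cov : CovariantDerivative I E (TangentSpace I : M → Type _))
    (V : Π x : M, TangentSpace I x) (x : M) : ℝ :=
  LinearMap.trace ℝ (TangentSpace I x) (cov V x : TangentSpace I x →ₗ[ℝ] TangentSpace I x)

variable [FiniteDimensional ℝ E]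

instance instFiniteDimensionalTangentSpace (x : M) : FiniteDimensional ℝ (TangentSpace I x) :=
  inferInstanceAs (FiniteDimensional ℝ E)

variable [RiemannianBundle (fun x : M ↦ TangentSpace I x)]

/-- An orthonormal basis of the tangent space at `x`. -/
def frame (I : ModelWithCorners ℝ E H) {M : Type*} [TopologicalSpace M] [ChartedSpace H M]
    [IsManifold I ∞ M] [RiemannianBundle (fun x : M ↦ TangentSpace I x)] (x : M) :
    OrthonormalBasis (Fin (Module.finrank ℝ (TangentSpace I x))) ℝ (TangentSpace I x) :=
  stdOrthonormalBasis ℝ (TangentSpace I x)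

/-- The Ricci tensor `S(v, w) = ∑ᵢ g(R(eᵢ, v)w, eᵢ)` of a connection. -/
def ricci (cov : CovariantDerivative I E (TangentSpace I : M → Type _)) (x : M)
    (v w : TangentSpace I x) : ℝ :=
  ∑ i, inner ℝ (curvature cov x (frame I x i) v w) (frame I x i)

/-- The scalar curvature `r = ∑ᵢ S(eᵢ, eᵢ)` of a connection. -/
def scalarCurvature (cov : CovariantDerivative I E (TangentSpace I : M → Type _)) (x : M) : ℝ :=
  ∑ i, ricci cov x (frame I x i) (frame I x i)

/-- The `*`-Ricci tensor `S*(v, w) = 1/2 trace (φ ∘ R(v, φ w))` of a connection. -/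
def starRicci (φ : Π x : M, TangentSpace I x →L[ℝ] TangentSpace I x)
    (cov : CovariantDerivative I E (TangentSpace I : M → Type _)) (x : M)
    (v w : TangentSpace I x) : ℝ :=
  (1 / 2) * ∑ i, inner ℝ (φ x (curvature cov x v (φ x w) (frame I x i))) (frame I x i)

/-- The `*`-scalar curvature `r* = ∑ᵢ S*(eᵢ, eᵢ)` of a connection. -/
def starScalarCurvature (φ : Π x : M, TangentSpace I x →L[ℝ] TangentSpace I x)
    (cov : CovariantDerivative I E (TangentSpace I : M → Type _)) (x : M) : ℝ :=
  ∑ i, starRicci φ cov x (frame I x i) (frame I x i)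

/-- The Lie derivative `(£_V g)(v, w) = g(∇_v V, w) + g(v, ∇_w V)` of the metric along `V` with
respect to a connection. -/
def lieDerivMetric (cov : CovariantDerivative I E (TangentSpace I : M → Type _))
    (V : Π x : M, TangentSpace I x) (x : M) (v w : TangentSpace I x) : ℝ :=
  inner ℝ (cov V x v) w + inner ℝ v (cov V x w)

/-- The connection is compatible with the metric:
`v g(X, Y) = g(∇_v X, Y) + g(X, ∇_v Y)` for all tangent vectors `v` at `x` and all vector fields
`X`, `Y` differentiable at `x`. -/
def IsMetric (cov : CovariantDerivative I E (TangentSpace I : M → Type _)) : Prop :=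
  ∀ (x : M) (X Y : Π x : M, TangentSpace I x), MDiffAt (T% X) x → MDiffAt (T% Y) x →
    ∀ v : TangentSpace I x,
      mvfderiv I (fun y ↦ (inner ℝ (X y) (Y y) : ℝ)) x v
        = inner ℝ (cov X x v) (Y x) + inner ℝ (X x) (cov Y x v)

/-- `cov` is the Levi-Civita connection: metric and torsion-free. -/
def IsLeviCivita (cov : CovariantDerivative I E (TangentSpace I : M → Type _)) : Prop :=
  IsMetric cov ∧ cov.torsion = 0

end Curvature

/-! ### Almost contact metric structures and `α`-cosymplectic manifolds -/

section Contact

variable {E : Type*} [NormedAddCommGroup E] [NormedSpace ℝ E] [FiniteDimensional ℝ E]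
  {H : Type*} [TopologicalSpace H] (I : ModelWithCorners ℝ E H)
  (M : Type*) [TopologicalSpace M] [ChartedSpace H M] [IsManifold I ∞ M]
  [RiemannianBundle (fun x : M ↦ TangentSpace I x)]

/-- An almost contact metric structure `(φ, ξ, η, g)` on a smooth manifold, `g` being the given
Riemannian metric. -/
structure AlmostContactMetricStructure where
  /-- the (1,1)-tensor field -/
  φ : Π x : M, TangentSpace I x →L[ℝ] TangentSpace I x
  /-- the characteristic vector field -/
  ξ : Π x : M, TangentSpace I x
  /-- the 1-form -/
  η : Π x : M, TangentSpace I x →L[ℝ] ℝ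
  contMDiff_φ : ContMDiff I (I.prod 𝓘(ℝ, E →L[ℝ] E)) ∞
    (fun x ↦ TotalSpace.mk' (E →L[ℝ] E)
      (E := fun x : M ↦ (TangentSpace I x →L[ℝ] TangentSpace I x)) x (φ x))
  contMDiff_ξ : ContMDiff I (I.prod 𝓘(ℝ, E)) ∞
    (fun x ↦ TotalSpace.mk' E (E := fun x : M ↦ TangentSpace I x) x (ξ x))
  contMDiff_η : ContMDiff I (I.prod 𝓘(ℝ, E →L[ℝ] ℝ)) ∞
    (fun x ↦ TotalSpace.mk' (E →L[ℝ] ℝ)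
      (E := fun x : M ↦ (TangentSpace I x →L[ℝ] Bundle.Trivial M ℝ x)) x (η x))
  φ_φ : ∀ (x : M) (v : TangentSpace I x), φ x (φ x v) = -v + η x v • ξ x
  η_ξ : ∀ x : M, η x (ξ x) = 1
  η_φ : ∀ (x : M) (v : TangentSpace I x), η x (φ x v) = 0
  φ_ξ : ∀ x : M, φ x (ξ x) = 0
  inner_φ_φ : ∀ (x : M) (v w : TangentSpace I x),
    inner ℝ (φ x v) (φ x w) = inner ℝ v w - η x v * η x w
  inner_φ_right : ∀ (x : M) (v w : TangentSpace I x), inner ℝ v (φ x w) = -inner ℝ (φ x v) w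
  inner_ξ : ∀ (x : M) (v : TangentSpace I x), inner ℝ v (ξ x) = η x v

namespace AlmostContactMetricStructure

variable {I M} (A : AlmostContactMetricStructure I M)

/-- The fundamental 2-form `Φ(v, w) = g(φ v, w)`. -/
def fundamentalForm (x : M) (v w : TangentSpace I x) : ℝ := inner ℝ (A.φ x v) w

/-- `(M, φ, ξ, η, g)` is an `α`-cosymplectic manifold: it is normal (the Nijenhuis torsion
vanishes), `dη = 0` and `dΦ = 2α η ∧ Φ`. -/
structure IsAlphaCosymplectic (α : ℝ) : Prop where
  dη_eq : ∀ (x : M) (X Y : Π x : M, TangentSpace I x), MDiffAt (T% X) x → MDiffAt (T% Y) x →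
    extDerivOne I A.η X Y x = 0
  dΦ_eq : ∀ (x : M) (X Y Z : Π x : M, TangentSpace I x),
    MDiffAt (T% X) x → MDiffAt (T% Y) x → MDiffAt (T% Z) x →
    extDerivTwo I A.fundamentalForm X Y Z x =
      2 * α * (A.η x (X x) * A.fundamentalForm x (Y x) (Z x)
        + A.η x (Y x) * A.fundamentalForm x (Z x) (X x)
        + A.η x (Z x) * A.fundamentalForm x (X x) (Y x))
  normal : ∀ (x : M) (X Y : Π x : M, TangentSpace I x), MDiffAt (T% X) x → MDiffAt (T% Y) x →
    nijenhuis I A.φ A.ξ A.η X Y x = 0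

/-- The metric is a `*-η`-Ricci-Yamabe soliton of constants `ρ, q, Λ, μ` with respect to the
connection `cov`:
`£_ξ g + 2ρ S* + (2Λ - q r*) g + 2μ η ⊗ η = 0`,
with the Lie derivative of the metric, the `*`-Ricci tensor and the `*`-scalar curvature formed
with `cov`. -/
def IsStarEtaRicciYamabeSoliton (cov : CovariantDerivative I E (TangentSpace I : M → Type _))
    (ρ q Λ μ : ℝ) : Prop :=
  ∀ (x : M) (v w : TangentSpace I x),
    lieDerivMetric cov A.ξ x v w + 2 * ρ * starRicci A.φ cov x v w
      + (2 * Λ - q * starScalarCurvature A.φ cov x) * inner ℝ v w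
      + 2 * μ * (A.η x v * A.η x w) = 0

/-- The `*-η`-Ricci-Yamabe soliton equation on an `n`-dimensional `α`-cosymplectic manifold,
`£_ξ g + 2ρ S + (2Λ + 2α²ρ(n-2) - q r - qα²(n-1)²) g + (2μ + 2α²ρ) η ⊗ η = 0`,
with the Lie derivative of the metric, the Ricci tensor and the scalar curvature formed with
`cov`. That is, the soliton equation with `S + α²(n-2) g + α² η ⊗ η` as `*`-Ricci tensor and
`r + α²(n-1)²` as `*`-scalar curvature. -/
def IsStarEtaRicciYamabeSolitonRicciForm
    (cov : CovariantDerivative I E (TangentSpace I : M → Type _))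
    (α ρ q Λ μ : ℝ) : Prop :=
  ∀ (x : M) (v w : TangentSpace I x),
    lieDerivMetric cov A.ξ x v w + 2 * ρ * ricci cov x v w
      + (2 * Λ + 2 * α ^ 2 * ρ * ((Module.finrank ℝ E : ℝ) - 2) - q * scalarCurvature cov x
          - q * α ^ 2 * ((Module.finrank ℝ E : ℝ) - 1) ^ 2) * inner ℝ v w
      + (2 * μ + 2 * α ^ 2 * ρ) * (A.η x v * A.η x w) = 0

/-- `cov` is a quarter-symmetric metric connection of the almost contact metric structure: it is
compatible with `g`, and its torsion is `T(X, Y) = η(Y) φX - η(X) φY`. -/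
def IsQuarterSymmetricMetric
    (cov : CovariantDerivative I E (TangentSpace I : M → Type _)) : Prop :=
  IsMetric cov ∧ ∀ (x : M) (v w : TangentSpace I x),
    cov.torsion x v w = A.η x w • A.φ x v - A.η x v • A.φ x w

end AlmostContactMetricStructure

end Contact

end AlphaCosymplectic

end

/-!
Both soliton equations are linear in `(Λ, μ)` at each point, with coefficients `g` and `η ⊗ η`.
Evaluating at `(ξ, ξ)` and taking the trace gives two equations whose solution is the claimed pair,
once everything formed with the quarter-symmetric connection is expressed through the Levi-Civita
connection `∇`.

* On an `α`-cosymplectic manifold, `(∇_u φ) v = α (g(φ u, v) ξ - η(v) φ u)` and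
  `∇_u ξ = α (u - η(u) ξ)` (`IsAlphaCosymplectic.covDerivφ_and_cov_ξ`). This is pointwise linear
  algebra (`IsAlmostContactMetric.eq_of_cyclic`): `∇φ` minus its expected value is skew, has
  vanishing cyclic sum because of `dΦ`, and satisfies a linear relation because of normality; these
  identities force it to be zero.
* Differentiating once more gives `R(u, v)ξ` and the commutator of `φ` with `R(u, v)`
  (`curvature_ξ`, `curvature_φ`), hence `S(ξ, ξ) = -α² (n - 1)` and
  `S* = S + α² (n - 2) g + α² η ⊗ η` (`ricci_ξ_ξ`, `IsAlphaCosymplectic.starRicci_eq`).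
* The quarter-symmetric connection is `∇ - η ⊗ φ` (`IsQuarterSymmetricMetric.cov_eq`). Since
  `dη = 0`, its curvature is `R(u, v)w + η(u) (∇_v φ) w - η(v) (∇_u φ) w`
  (`IsQuarterSymmetricMetric.curvature_eq`), so its `*`-Ricci tensor is `S*` and its Ricci tensor is
  `S + α Φ`, with the same quadratic form as `S`. Both soliton equations therefore have the same
  quadratic form (`IsQuarterSymmetricMetric.soliton_quadratic`).

The Riemannian background is developed for vector fields that are `C^2` at a point. The commutator
formula `X Y f - Y X f = [X, Y] f` is read off the Jacobi identity for `X`, `Y` and `f Z`. The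
Koszul formula shows that `∇_X Y` is `C^1`, so that second covariant derivatives make sense. The
symmetries of the curvature are proved for fields, and tensoriality and multilinearity of the
curvature are deduced from them (`IsCurvatureTensor`, `IsLeviCivita.curvature_apply`).
-/

open Bundle
open scoped Manifold ContDiff

noncomputable section

namespace AlphaCosymplectic

open VectorField FiberBundle

set_option linter.unusedSectionVars false

/-! ### Vector fields as derivations -/

section Smoothness

variable {E : Type*} [NormedAddCommGroup E] [NormedSpace ℝ E]
  {H : Type*} [TopologicalSpace H] {I : ModelWithCorners ℝ E H}
  {M : Type*} [TopologicalSpace M] [ChartedSpace H M] [IsManifold I ∞ M]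

theorem isManifold_minSmoothness_two : IsManifold I (minSmoothness ℝ 2) M := by
  rw [minSmoothness_of_isRCLikeNormedField]
  infer_instance

theorem isManifold_minSmoothness_three : IsManifold I (minSmoothness ℝ 3) M := by
  rw [minSmoothness_of_isRCLikeNormedField]
  exact IsManifold.of_le (n := ∞) (WithTop.coe_le_coe.2 (le_top : (3 : ℕ∞) ≤ ⊤))

end Smoothness

attribute [local instance] isManifold_minSmoothness_two isManifold_minSmoothness_three

section Calculus

variable {E : Type*} [NormedAddCommGroup E] [NormedSpace ℝ E] [FiniteDimensional ℝ E]
  {H : Type*} [TopologicalSpace H] {I : ModelWithCorners ℝ E H}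
  {M : Type*} [TopologicalSpace M] [ChartedSpace H M] [IsManifold I ∞ M]

theorem eventually_contMDiffAt_section {X : Π x : M, TangentSpace I x} {x : M}
    (hX : CMDiffAt 2 (T% X) x) : ∀ᶠ y in nhds x, CMDiffAt 2 (T% X) y :=
  (contMDiffAt_iff_contMDiffAt_nhds (by simp)).1 hX

theorem eventually_contMDiffAt_fun {f : M → ℝ} {x : M}
    (hf : CMDiffAt 2 f x) : ∀ᶠ y in nhds x, CMDiffAt 2 f y :=
  (contMDiffAt_iff_contMDiffAt_nhds (by simp)).1 hf

theorem mvfderiv_congr {f f' : M → ℝ} {x : M} (h : ∀ᶠ y in nhds x, f y = f' y) :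
    mvfderiv I f x = mvfderiv I f' x := by
  have h1 : mfderiv I 𝓘(ℝ, ℝ) f x = mfderiv I 𝓘(ℝ, ℝ) f' x := Filter.EventuallyEq.mfderiv_eq h
  ext v
  exact DFunLike.congr_fun h1 v

/-- The bracket of two `C^2` vector fields is `C^1`. -/
theorem contMDiffAt_mlieBracket {X Y : Π x : M, TangentSpace I x} {x : M}
    (hX : CMDiffAt 2 (T% X) x) (hY : CMDiffAt 2 (T% Y) x) :
    CMDiffAt 1 (T% (mlieBracket I X Y)) x := by
  have : IsManifold I (((2 : ℕ∞) : ℕ∞ω) + 1) M :=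
    IsManifold.of_le (n := ∞) (WithTop.coe_le_coe.2 (le_top : (3 : ℕ∞) ≤ ⊤))
  exact ContMDiffAt.mlieBracket_vectorField (m := 1) (n := 2) hX hY
    (by rw [minSmoothness_of_isRCLikeNormedField]; norm_num)

theorem exists_contMDiffAt_ne_zero [Nontrivial E] (x : M) :
    ∃ Z : Π x : M, TangentSpace I x, CMDiffAt 2 (T% Z) x ∧ Z x ≠ 0 := by
  obtain ⟨v, hv⟩ := exists_ne (0 : E)
  refine ⟨extend E (show TangentSpace I x from v), contMDiffAt_extend .., ?_⟩
  rw [extend_apply_self]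
  exact hv

/-- The Leibniz rule `[Y, f Z] = (Y f) Z + f [Y, Z]` near a point of regularity. It turns statements
about second derivatives of functions into statements about brackets. -/
theorem mlieBracket_smul_eventuallyEq {Y Z : Π x : M, TangentSpace I x} {f : M → ℝ} {x : M}
    (hZ : CMDiffAt 2 (T% Z) x) (hf : CMDiffAt 2 f x) :
    ∀ᶠ y in nhds x, mlieBracket I Y (f • Z) y
      = ((fun y ↦ mvfderiv I f y (Y y)) • Z + f • mlieBracket I Y Z) y := by
  filter_upwards [eventually_contMDiffAt_section hZ, eventually_contMDiffAt_fun hf] with y h1 h2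
  rw [mlieBracket_smul_right (h2.mdifferentiableAt (by simp)) (h1.mdifferentiableAt (by simp))]
  rfl

variable [RiemannianBundle (fun x : M ↦ TangentSpace I x)]
  [IsContMDiffRiemannianBundle I ∞ E (fun x : M ↦ TangentSpace I x)]

theorem contMDiffAt_inner {n : ℕ∞} {X Y : Π x : M, TangentSpace I x} {x : M}
    (hX : CMDiffAt n (T% X) x) (hY : CMDiffAt n (T% Y) x) :
    CMDiffAt n (fun y ↦ (inner ℝ (X y) (Y y) : ℝ)) x := by
  have : IsContMDiffRiemannianBundle I n E (fun x : M ↦ TangentSpace I x) :=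
    IsContMDiffRiemannianBundle.of_le (n := ∞) (WithTop.coe_le_coe.2 le_top)
  exact ContMDiffAt.inner_bundle hX hY

theorem mdifferentiableAt_inner {Y Z : Π x : M, TangentSpace I x} {x : M}
    (hY : MDiffAt (T% Y) x) (hZ : MDiffAt (T% Z) x) :
    MDiffAt (fun y ↦ (inner ℝ (Y y) (Z y) : ℝ)) x := by
  have : IsContMDiffRiemannianBundle I 1 E (fun x : M ↦ TangentSpace I x) :=
    IsContMDiffRiemannianBundle.of_le (n := ∞) (WithTop.coe_le_coe.2 le_top)
  exact MDifferentiableAt.inner_bundle hY hZ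

/-- The derivative `Y f` of a `C^2` function along a `C^2` vector field is `C^1`: for a `C^2` field
`Z` with `Z x ≠ 0`, it is the coefficient of `Z` in `[Y, f Z] - f [Y, Z]`. -/
theorem contMDiffAt_mvfderiv_apply [Nontrivial E] {Y : Π x : M, TangentSpace I x} {f : M → ℝ}
    {x : M} (hY : CMDiffAt 2 (T% Y) x) (hf : CMDiffAt 2 f x) :
    CMDiffAt 1 (fun y ↦ mvfderiv I f y (Y y)) x := by
  obtain ⟨Z, hZ, hZx⟩ := exists_contMDiffAt_ne_zero (I := I) x
  have hZ1 : CMDiffAt 1 (T% Z) x := hZ.of_le (by norm_num)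
  have h1 : CMDiffAt 1 (T% (mlieBracket I Y (f • Z) - f • mlieBracket I Y Z)) x :=
    (contMDiffAt_mlieBracket hY (hf.smul_section hZ)).sub_section
      ((hf.of_le (by norm_num)).smul_section (contMDiffAt_mlieBracket hY hZ))
  have h2 := contMDiffAt_inner (n := 1) h1 hZ1
  have h3 := contMDiffAt_inner (n := 1) hZ1 hZ1
  have hne : (inner ℝ (Z x) (Z x) : ℝ) ≠ 0 := by simpa using hZx
  refine (h2.div₀ h3 hne).congr_of_eventuallyEq ?_
  filter_upwards [mlieBracket_smul_eventuallyEq (Y := Y) hZ hf,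
    h3.continuousAt.eventually_ne hne] with y hy hy0
  simp only [Pi.div_apply, Pi.sub_apply]
  rw [hy, eq_div_iff hy0]
  simp [inner_smul_left]

/-- A second derivative along vector fields is symmetric up to the bracket: `[X, Y]` acts on
functions as the commutator of `X` and `Y`. For a field `Z` with `Z x ≠ 0`, this is the coefficient
of `Z x` in the Jacobi identity for `X`, `Y` and `f • Z`. -/
theorem mvfderiv_mlieBracket [Nontrivial E] {X Y : Π x : M, TangentSpace I x} {f : M → ℝ} {x : M}
    (hX : CMDiffAt 2 (T% X) x) (hY : CMDiffAt 2 (T% Y) x) (hf : CMDiffAt 2 f x) :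
    mvfderiv I f x (mlieBracket I X Y x) =
      mvfderiv I (fun y ↦ mvfderiv I f y (Y y)) x (X x)
        - mvfderiv I (fun y ↦ mvfderiv I f y (X y)) x (Y x) := by
  obtain ⟨Z, hZ, hZx⟩ := exists_contMDiffAt_ne_zero (I := I) x
  have two : (2 : ℕ∞ω) ≠ 0 := by simp
  have key : ∀ {X Y : Π x : M, TangentSpace I x}, CMDiffAt 2 (T% X) x → CMDiffAt 2 (T% Y) x →
      mlieBracket I X (mlieBracket I Y (f • Z)) x =
        mvfderiv I (fun y ↦ mvfderiv I f y (Y y)) x (X x) • Z x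
        + mvfderiv I f x (Y x) • mlieBracket I X Z x
        + (mvfderiv I f x (X x) • mlieBracket I Y Z x
          + f x • mlieBracket I X (mlieBracket I Y Z) x) := by
    intro X Y hX hY
    have d1 := (contMDiffAt_mvfderiv_apply hY hf).mdifferentiableAt one_ne_zero
    have d2 := (contMDiffAt_mlieBracket hY hZ).mdifferentiableAt one_ne_zero
    have d3 := hZ.mdifferentiableAt two
    have d4 := hf.mdifferentiableAt two
    rw [Filter.EventuallyEq.mlieBracket_vectorField_eq (V₁ := X) (W₁ := mlieBracket I Y (f • Z))
        Filter.EventuallyEq.rfl (mlieBracket_smul_eventuallyEq (Y := Y) hZ hf),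
      mlieBracket_add_right (d1.smul_section d3) (d4.smul_section d2),
      mlieBracket_smul_right d1 d3, mlieBracket_smul_right d4 d2]
  have J := leibniz_identity_mlieBracket_apply (I := I) (x := x) (U := X) (V := Y) (W := f • Z)
    (by simpa [minSmoothness_of_isRCLikeNormedField] using hX)
    (by simpa [minSmoothness_of_isRCLikeNormedField] using hY)
    (by simpa [minSmoothness_of_isRCLikeNormedField] using hf.smul_section hZ)
  have J' := leibniz_identity_mlieBracket_apply (I := I) (x := x) (U := X) (V := Y) (W := Z)
    (by simpa [minSmoothness_of_isRCLikeNormedField] using hX)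
    (by simpa [minSmoothness_of_isRCLikeNormedField] using hY)
    (by simpa [minSmoothness_of_isRCLikeNormedField] using hZ)
  rw [key hX hY, key hY hX, mlieBracket_smul_right (hf.mdifferentiableAt two)
    (hZ.mdifferentiableAt two), J'] at J
  have : (mvfderiv I f x (mlieBracket I X Y x) -
      (mvfderiv I (fun y ↦ mvfderiv I f y (Y y)) x (X x)
        - mvfderiv I (fun y ↦ mvfderiv I f y (X y)) x (Y x))) • Z x = 0 := by
    rw [← sub_eq_zero] at J
    rw [← neg_eq_zero, ← J]
    module
  exact sub_eq_zero.1 ((smul_eq_zero.1 this).resolve_right hZx)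

end Calculus

/-! ### Regularity of the Levi-Civita connection -/

section LeviCivita

variable {E : Type*} [NormedAddCommGroup E] [NormedSpace ℝ E] [FiniteDimensional ℝ E]
  {H : Type*} [TopologicalSpace H] {I : ModelWithCorners ℝ E H}
  {M : Type*} [TopologicalSpace M] [ChartedSpace H M] [IsManifold I ∞ M]
  [RiemannianBundle (fun x : M ↦ TangentSpace I x)]
  [IsContMDiffRiemannianBundle I ∞ E (fun x : M ↦ TangentSpace I x)]

theorem contMDiffAt_det {n : ℕ∞ω} {ι : Type*} [Fintype ι] [DecidableEq ι]
    {A : M → Matrix ι ι ℝ} {x : M} (hA : ∀ i j, CMDiffAt n (fun y ↦ A y i j) x) :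
    CMDiffAt n (fun y ↦ (A y).det) x := by
  simp only [Matrix.det_apply']
  exact contMDiffAt_finsetSum fun σ _ ↦
    contMDiffAt_const.mul (contMDiffAt_finsetProd fun i _ ↦ hA _ _)

/-- A vector field is `C^1` if its inner products with all `C^2` fields are: by Cramer's rule, its
coefficients in a local frame are quotients of determinants of such inner products, the denominator
being the Gram determinant of the frame. -/
theorem contMDiffAt_of_contMDiffAt_inner {W : Π x : M, TangentSpace I x} {x : M}
    (hW : ∀ Z : Π x : M, TangentSpace I x, CMDiffAt 2 (T% Z) x →
      CMDiffAt 1 (fun y ↦ (inner ℝ (W y) (Z y) : ℝ)) x) :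
    CMDiffAt 1 (T% W) x := by
  classical
  let b := Module.finBasis ℝ E
  let t := trivializationAt E (TangentSpace I : M → Type _) x
  have hx : x ∈ t.baseSet := FiberBundle.mem_baseSet_trivializationAt' x
  let e := t.localFrame b
  have he : IsLocalFrameOn I E 1 e t.baseSet := t.isLocalFrameOn_localFrame_baseSet I 1 b
  have he2 : ∀ i, CMDiffAt 2 (T% (e i)) x := fun i ↦ contMDiffAt_localFrame_of_mem 2 t b i hx
  let G : M → Matrix _ _ ℝ := fun y ↦ Matrix.gram ℝ (fun i ↦ e i y)
  let β : M → _ → ℝ := fun y i ↦ inner ℝ (W y) (e i y)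
  have hG : ∀ i j, CMDiffAt 1 (fun y ↦ G y i j) x := fun i j ↦
    (contMDiffAt_inner (n := 2) (he2 i) (he2 j)).of_le (by norm_num)
  have hβ : ∀ i, CMDiffAt 1 (fun y ↦ β y i) x := fun i ↦ hW _ (he2 i)
  have hdet : ∀ y ∈ t.baseSet, (G y).det ≠ 0 := fun y hy ↦
    Matrix.det_gram_ne_zero_iff_linearIndependent.2 (he.linearIndependent hy)
  refine he.contMDiffAt_of_coeff_aux (fun i ↦ ?_) t.open_baseSet hx
  have hc : CMDiffAt 1 (fun y ↦ (G y).cramer (β y) i / (G y).det) x := by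
    refine ContMDiffAt.div₀ ?_ (contMDiffAt_det hG) (hdet x hx)
    simp only [Matrix.cramer_apply]
    refine contMDiffAt_det fun j k ↦ ?_
    by_cases hk : k = i
    · subst hk
      simpa using hβ j
    · simpa [hk] using hG j k
  refine hc.congr_of_eventuallyEq ?_
  filter_upwards [t.open_baseSet.mem_nhds hx] with y hy
  have hβy : β y = (G y).mulVec (fun j ↦ he.coeff j y (W y)) := by
    ext j
    simp only [β, G, Matrix.mulVec, dotProduct, Matrix.gram_apply]
    conv_lhs => rw [he.coeff_sum_eq W hy]
    rw [sum_inner]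
    refine Finset.sum_congr rfl fun k _ ↦ ?_
    rw [real_inner_smul_left, real_inner_comm, mul_comm]
  rw [eq_div_iff (hdet y hy), hβy, Matrix.cramer_eq_adjugate_mulVec, Matrix.mulVec_mulVec,
    Matrix.adjugate_mul]
  simp [Matrix.smul_mulVec, mul_comm]

variable {cov : CovariantDerivative I E (TangentSpace I : M → Type _)}

theorem IsLeviCivita.cov_sub_cov (h : IsLeviCivita cov) {X Y : Π x : M, TangentSpace I x} {x : M}
    (hX : MDiffAt (T% X) x) (hY : MDiffAt (T% Y) x) :
    cov Y x (X x) - cov X x (Y x) = mlieBracket I X Y x :=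
  cov.torsion_eq_zero_iff.1 h.2 hX hY

/-- The Koszul formula. -/
theorem IsLeviCivita.koszul (h : IsLeviCivita cov) {X Y Z : Π x : M, TangentSpace I x} {x : M}
    (hX : MDiffAt (T% X) x) (hY : MDiffAt (T% Y) x) (hZ : MDiffAt (T% Z) x) :
    (inner ℝ (cov Y x (X x)) (Z x) : ℝ) = (1 / 2) *
      (mvfderiv I (fun y ↦ (inner ℝ (Y y) (Z y) : ℝ)) x (X x)
      + mvfderiv I (fun y ↦ (inner ℝ (Z y) (X y) : ℝ)) x (Y x)
      - mvfderiv I (fun y ↦ (inner ℝ (X y) (Y y) : ℝ)) x (Z x)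
      + inner ℝ (mlieBracket I X Y x) (Z x)
      - inner ℝ (mlieBracket I Y Z x) (X x)
      + inner ℝ (mlieBracket I Z X x) (Y x)) := by
  rw [h.1 x Y Z hY hZ, h.1 x Z X hZ hX, h.1 x X Y hX hY, ← h.cov_sub_cov hX hY,
    ← h.cov_sub_cov hY hZ, ← h.cov_sub_cov hZ hX]
  simp only [inner_sub_left]
  rw [real_inner_comm (cov Z x (X x)) (Y x), real_inner_comm (cov X x (Y x)) (Z x),
    real_inner_comm (cov Y x (Z x)) (X x)]
  ring

/-- The Levi-Civita connection is regular although no regularity is part of its definition: by the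
Koszul formula `g(∇_X Y, Z)` is `C^1` for all `C^2` fields `Z`. -/
theorem IsLeviCivita.contMDiffAt_cov [Nontrivial E] (h : IsLeviCivita cov)
    {X Y : Π x : M, TangentSpace I x} {x : M}
    (hX : CMDiffAt 2 (T% X) x) (hY : CMDiffAt 2 (T% Y) x) :
    CMDiffAt 1 (T% (fun y ↦ cov Y y (X y))) x := by
  refine contMDiffAt_of_contMDiffAt_inner fun Z hZ ↦ ?_
  have d : ∀ {U V W : Π x : M, TangentSpace I x}, CMDiffAt 2 (T% U) x → CMDiffAt 2 (T% V) x →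
      CMDiffAt 2 (T% W) x →
      CMDiffAt 1 (fun y ↦ mvfderiv I (fun z ↦ (inner ℝ (U z) (V z) : ℝ)) y (W y)) x :=
    fun hU hV hW ↦ contMDiffAt_mvfderiv_apply hW (contMDiffAt_inner (n := 2) hU hV)
  have l : ∀ {U V W : Π x : M, TangentSpace I x}, CMDiffAt 2 (T% U) x → CMDiffAt 2 (T% V) x →
      CMDiffAt 2 (T% W) x → CMDiffAt 1 (fun y ↦ (inner ℝ (mlieBracket I U V y) (W y) : ℝ)) x :=
    fun hU hV hW ↦ contMDiffAt_inner (n := 1) (contMDiffAt_mlieBracket hU hV)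
      (hW.of_le (by norm_num))
  refine ContMDiffAt.congr_of_eventuallyEq (f := fun y ↦ (1 / 2 : ℝ) * _)
    (contMDiffAt_const.mul (((((d hY hZ hX).add (d hZ hX hY)).sub (d hX hY hZ)).add
      (l hX hY hZ)).sub (l hY hZ hX) |>.add (l hZ hX hY))) ?_
  filter_upwards [eventually_contMDiffAt_section hX, eventually_contMDiffAt_section hY,
    eventually_contMDiffAt_section hZ] with y h1 h2 h3
  rw [h.koszul (h1.mdifferentiableAt (by simp)) (h2.mdifferentiableAt (by simp))
    (h3.mdifferentiableAt (by simp))]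
  rfl

end LeviCivita

/-! ### Algebra of curvature tensors -/

section CurvatureTensor

variable {V : Type*} [NormedAddCommGroup V] [InnerProductSpace ℝ V]

/-- The algebraic identities of the curvature operator `R(u, v)w` of a Levi-Civita connection at a
point: it is skew in `u, v`, skew-adjoint in `w`, and satisfies the first Bianchi identity.
Multilinearity is not assumed; it follows from these identities. -/
structure IsCurvatureTensor (R : V → V → V → V) : Prop where
  swap : ∀ u v w, R u v w = -R v u w
  skew : ∀ u v w z, (inner ℝ (R u v w) z : ℝ) = -inner ℝ w (R u v z)
  bianchi : ∀ u v w, R u v w + R v w u + R w u v = 0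

namespace IsCurvatureTensor

variable {R : V → V → V → V} (hR : IsCurvatureTensor R)
include hR

/-- The pair symmetry `g(R(u, v)w, z) = g(R(w, z)u, v)`, by adding up the Bianchi identities of the
four cyclic permutations of `u, v, w, z`. -/
theorem pair_symm (u v w z : V) : (inner ℝ (R u v w) z : ℝ) = inner ℝ (R w z u) v := by
  have sw : ∀ a b c d, (inner ℝ (R a b c) d : ℝ) = -inner ℝ (R b a c) d := fun a b c d ↦ by
    rw [hR.swap, inner_neg_left]
  have sk : ∀ a b c d, (inner ℝ (R a b c) d : ℝ) = -inner ℝ (R a b d) c := fun a b c d ↦ by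
    rw [hR.skew, real_inner_comm]
  have bi : ∀ a b c d, (inner ℝ (R a b c) d : ℝ) + inner ℝ (R b c a) d + inner ℝ (R c a b) d = 0 :=
    fun a b c d ↦ by rw [← inner_add_left, ← inner_add_left, hR.bianchi, inner_zero_left]
  linarith [bi u v w z, bi v w z u, bi w z u v, bi z u v w, sk v w z u, sk w z v u, sw z v w u,
    sk v z w u, sw u w z v, sk w u z v, sk z u v w, sk u v z w]

theorem map_add_right (u v w w' : V) : R u v (w + w') = R u v w + R u v w' := by
  refine ext_inner_right ℝ fun z ↦ ?_
  simp only [inner_add_left, hR.skew]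
  ring

theorem map_smul_right (u v w : V) (c : ℝ) : R u v (c • w) = c • R u v w := by
  refine ext_inner_right ℝ fun z ↦ ?_
  simp only [real_inner_smul_left, hR.skew]
  ring

theorem map_add_left (u u' v w : V) : R (u + u') v w = R u v w + R u' v w := by
  refine ext_inner_right ℝ fun z ↦ ?_
  simp only [inner_add_left, hR.pair_symm _ _ w z, hR.map_add_right]

theorem map_smul_left (u v w : V) (c : ℝ) : R (c • u) v w = c • R u v w := by
  refine ext_inner_right ℝ fun z ↦ ?_
  simp only [real_inner_smul_left, hR.pair_symm _ _ w z, hR.map_smul_right]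

end IsCurvatureTensor
end CurvatureTensor

/-! ### The curvature of the Levi-Civita connection -/

section LeviCivitaCurvature

variable {E : Type*} [NormedAddCommGroup E] [NormedSpace ℝ E] [FiniteDimensional ℝ E]
  {H : Type*} [TopologicalSpace H] {I : ModelWithCorners ℝ E H}
  {M : Type*} [TopologicalSpace M] [ChartedSpace H M] [IsManifold I ∞ M]

/-- A connection only sees the germ of a field. -/
theorem cov_congr (cov : CovariantDerivative I E (TangentSpace I : M → Type _))
    {X Y : Π x : M, TangentSpace I x} {x : M} (hY : MDiffAt (T% Y) x)
    (h : ∀ᶠ y in nhds x, X y = Y y) : cov X x = cov Y x := by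
  have hX : MDiffAt (T% X) x := by
    refine hY.congr_of_eventuallyEq ?_
    filter_upwards [h] with y hy
    rw [hy]
  exact cov.isCovariantDerivativeOnUniv.congr_of_eventuallyEq hX hY Filter.univ_mem h

theorem curvatureField_swap (cov : CovariantDerivative I E (TangentSpace I : M → Type _))
    (X Y Z : Π x : M, TangentSpace I x) (x : M) :
    curvatureField cov X Y Z x = -curvatureField cov Y X Z x := by
  simp only [curvatureField]
  rw [mlieBracket_swap_apply (V := Y), map_neg]
  abel

variable [RiemannianBundle (fun x : M ↦ TangentSpace I x)]
  [IsContMDiffRiemannianBundle I ∞ E (fun x : M ↦ TangentSpace I x)]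
  {cov : CovariantDerivative I E (TangentSpace I : M → Type _)} [Nontrivial E]

namespace IsLeviCivita

variable (h : IsLeviCivita cov)
include h

theorem mdifferentiableAt_cov {X Y : Π x : M, TangentSpace I x} {x : M}
    (hX : CMDiffAt 2 (T% X) x) (hY : CMDiffAt 2 (T% Y) x) :
    MDiffAt (T% (fun y ↦ cov Y y (X y))) x :=
  (h.contMDiffAt_cov hX hY).mdifferentiableAt one_ne_zero

theorem mvfderiv_mvfderiv_inner {X Y Z W : Π x : M, TangentSpace I x} {x : M}
    (hY : CMDiffAt 2 (T% Y) x)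
    (hZ : CMDiffAt 2 (T% Z) x) (hW : CMDiffAt 2 (T% W) x) :
    mvfderiv I (fun y ↦ mvfderiv I (fun z ↦ (inner ℝ (Z z) (W z) : ℝ)) y (Y y)) x (X x)
      = inner ℝ (cov (fun y ↦ cov Z y (Y y)) x (X x)) (W x)
        + inner ℝ (cov Z x (Y x)) (cov W x (X x))
        + (inner ℝ (cov Z x (X x)) (cov W x (Y x))
        + inner ℝ (Z x) (cov (fun y ↦ cov W y (Y y)) x (X x))) := by
  have hd : ∀ {U : Π x : M, TangentSpace I x}, CMDiffAt 2 (T% U) x → MDiffAt (T% U) x :=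
    fun hU ↦ hU.mdifferentiableAt two_ne_zero
  have h1 : ∀ᶠ y in nhds x, mvfderiv I (fun z ↦ (inner ℝ (Z z) (W z) : ℝ)) y (Y y)
      = inner ℝ (cov Z y (Y y)) (W y) + inner ℝ (Z y) (cov W y (Y y)) := by
    filter_upwards [eventually_contMDiffAt_section hZ, eventually_contMDiffAt_section hW]
      with y hy1 hy2
    exact h.1 y Z W (hy1.mdifferentiableAt two_ne_zero) (hy2.mdifferentiableAt two_ne_zero) _
  have d1 := (contMDiffAt_inner (n := 1) (h.contMDiffAt_cov hY hZ) (hW.of_le (by norm_num)))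
    |>.mdifferentiableAt one_ne_zero
  have d2 := (contMDiffAt_inner (n := 1) (hZ.of_le (by norm_num)) (h.contMDiffAt_cov hY hW))
    |>.mdifferentiableAt one_ne_zero
  rw [mvfderiv_congr h1, mvfderiv_fun_add d1 d2, _root_.add_apply,
    h.1 x _ _ (h.mdifferentiableAt_cov hY hZ) (hd hW), h.1 x _ _ (hd hZ)
      (h.mdifferentiableAt_cov hY hW)]

/-- Metric compatibility makes the curvature skew-adjoint: `X Y - Y X - [X, Y]` annihilates the
function `g(Z, W)`. -/
theorem inner_curvatureField {X Y Z W : Π x : M, TangentSpace I x} {x : M}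
    (hX : CMDiffAt 2 (T% X) x) (hY : CMDiffAt 2 (T% Y) x)
    (hZ : CMDiffAt 2 (T% Z) x) (hW : CMDiffAt 2 (T% W) x) :
    (inner ℝ (curvatureField cov X Y Z x) (W x) : ℝ)
      = -inner ℝ (Z x) (curvatureField cov X Y W x) := by
  have h1 := mvfderiv_mlieBracket hX hY (contMDiffAt_inner (n := 2) hZ hW)
  rw [h.1 x Z W (hZ.mdifferentiableAt two_ne_zero) (hW.mdifferentiableAt two_ne_zero),
    h.mvfderiv_mvfderiv_inner hY hZ hW, h.mvfderiv_mvfderiv_inner hX hZ hW] at h1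
  simp only [curvatureField, inner_sub_left, inner_sub_right]
  linarith

theorem curvatureField_bianchi {X Y Z : Π x : M, TangentSpace I x} {x : M}
    (hX : CMDiffAt 2 (T% X) x) (hY : CMDiffAt 2 (T% Y) x) (hZ : CMDiffAt 2 (T% Z) x) :
    curvatureField cov X Y Z x + curvatureField cov Y Z X x + curvatureField cov Z X Y x = 0 := by
  -- `∇_X ∇_Y Z - ∇_X ∇_Z Y = ∇_X [Y, Z] = [X, [Y, Z]] + ∇_[Y, Z] X`
  have key : ∀ {X Y Z : Π x : M, TangentSpace I x}, CMDiffAt 2 (T% X) x → CMDiffAt 2 (T% Y) x →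
      CMDiffAt 2 (T% Z) x →
      cov (fun y ↦ cov Z y (Y y)) x (X x) = cov (fun y ↦ cov Y y (Z y)) x (X x)
        + mlieBracket I X (mlieBracket I Y Z) x + cov X x (mlieBracket I Y Z x) := by
    intro X Y Z hX hY hZ
    have e : ∀ᶠ y in nhds x, cov Z y (Y y)
        = ((fun y ↦ cov Y y (Z y)) + mlieBracket I Y Z) y := by
      filter_upwards [eventually_contMDiffAt_section hY, eventually_contMDiffAt_section hZ]
        with y h1 h2
      rw [Pi.add_apply, ← h.cov_sub_cov (h1.mdifferentiableAt two_ne_zero)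
        (h2.mdifferentiableAt two_ne_zero)]
      abel
    have d1 := h.mdifferentiableAt_cov hZ hY
    have d2 := (contMDiffAt_mlieBracket hY hZ).mdifferentiableAt one_ne_zero
    rw [cov_congr cov (mdifferentiableAt_add_section d1 d2) e,
      cov.isCovariantDerivativeOnUniv.add d1 d2,
      _root_.add_apply, ← h.cov_sub_cov (hX.mdifferentiableAt two_ne_zero) d2]
    abel
  have J := leibniz_identity_mlieBracket_apply (I := I) (x := x) (U := X) (V := Y) (W := Z)
    (by simpa [minSmoothness_of_isRCLikeNormedField] using hX)
    (by simpa [minSmoothness_of_isRCLikeNormedField] using hY)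
    (by simpa [minSmoothness_of_isRCLikeNormedField] using hZ)
  rw [mlieBracket_swap_apply (V := mlieBracket I X Y), mlieBracket_swap (V := X) (W := Z)] at J
  have hneg : mlieBracket I Y (-mlieBracket I Z X) x = -mlieBracket I Y (mlieBracket I Z X) x := by
    have := mlieBracket_const_smul_right (I := I) (V := Y) (c := (-1 : ℝ))
      ((contMDiffAt_mlieBracket hZ hX).mdifferentiableAt one_ne_zero)
    simpa using this
  rw [hneg] at J
  simp only [curvatureField]
  rw [key hX hY hZ, key hY hZ hX, key hZ hX hY, J]
  abel

theorem isCurvatureTensor (x : M) : IsCurvatureTensor (curvature cov x) where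
  swap _ _ _ := curvatureField_swap ..
  skew u v w z := by
    have := h.inner_curvatureField (contMDiffAt_extend (k := 2) I E u)
      (contMDiffAt_extend (k := 2) I E v)
      (contMDiffAt_extend (k := 2) I E w) (contMDiffAt_extend (k := 2) I E z)
    simp only [extend_apply_self] at this
    exact this
  bianchi u v w := h.curvatureField_bianchi (contMDiffAt_extend ..) (contMDiffAt_extend ..)
    (contMDiffAt_extend ..)

/-- The curvature at `x` depends on the differentiated field only through its value at `x`, as it is
adjoint to an expression of order zero. -/
theorem curvature_apply {Z : Π x : M, TangentSpace I x} {x : M} (hZ : CMDiffAt 2 (T% Z) x)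
    (u v : TangentSpace I x) :
    curvature cov x u v (Z x) = curvatureField cov (extend E u) (extend E v) Z x := by
  refine ext_inner_right ℝ fun z ↦ ?_
  have := h.inner_curvatureField (contMDiffAt_extend (k := 2) I E u)
      (contMDiffAt_extend (k := 2) I E v) hZ (contMDiffAt_extend (k := 2) I E z)
  rw [extend_apply_self] at this
  rw [this, (h.isCurvatureTensor x).skew]
  rfl

end IsLeviCivita
end LeviCivitaCurvature

/-! ### Almost contact metric structures on a vector space -/

section ContactAlgebra

variable {V : Type*} [NormedAddCommGroup V] [InnerProductSpace ℝ V]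

/-- An almost contact metric structure `(φ, ξ)` on an inner product space, the 1-form being
`v ↦ ⟪v, ξ⟫`. -/
structure IsAlmostContactMetric (φ : V →ₗ[ℝ] V) (ξ : V) : Prop where
  φ_φ : ∀ v, φ (φ v) = -v + (inner ℝ v ξ : ℝ) • ξ
  inner_ξ_ξ : (inner ℝ ξ ξ : ℝ) = 1
  φ_ξ : φ ξ = 0
  skew : ∀ v w, (inner ℝ v (φ w) : ℝ) = -inner ℝ (φ v) w

namespace IsAlmostContactMetric

variable {φ : V →ₗ[ℝ] V} {ξ : V} (hφ : IsAlmostContactMetric φ ξ)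
include hφ

theorem inner_φ_ξ (v : V) : (inner ℝ (φ v) ξ : ℝ) = 0 := by
  rw [← neg_eq_zero, ← hφ.skew, hφ.φ_ξ, inner_zero_right]

theorem inner_ξ_φ (v : V) : (inner ℝ ξ (φ v) : ℝ) = 0 := by
  rw [real_inner_comm, hφ.inner_φ_ξ]

theorem inner_φ_self (v : V) : (inner ℝ (φ v) v : ℝ) = 0 := by
  have := hφ.skew v v
  rw [real_inner_comm] at this
  linarith

theorem inner_φ_swap (v w : V) : (inner ℝ (φ v) w : ℝ) = -inner ℝ (φ w) v := by
  rw [real_inner_comm, hφ.skew]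

/-- A trilinear form, skew in its last two arguments, vanishes as soon as its cyclic sum and its
Nijenhuis-type expression vanish and it kills `(ξ, ξ, ·)`. Together the cyclic sum and the Nijenhuis
expression say that `c (φ u) v w + c (φ v) w u = c (φ w) u v`; adding the cyclic permutations of
this relation gives `c (φ u) v w = 0`. -/
theorem eq_zero_of_cyclic {c : V →ₗ[ℝ] V →ₗ[ℝ] V →ₗ[ℝ] ℝ}
    (skew : ∀ u v w, c u v w = -c u w v)
    (cyc : ∀ u v w, c u v w + c v w u + c w u v = 0)
    (nij : ∀ u v w, c (φ u) v w - c (φ v) u w - c v u (φ w) + c u v (φ w) = 0)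
    (hξ : ∀ w, c ξ ξ w = 0) (u v w : V) : c u v w = 0 := by
  have rel : ∀ u v w, c (φ u) v w + c (φ v) w u - c (φ w) u v = 0 := fun u v w ↦ by
    linarith [nij u v w, cyc u v (φ w), skew v (φ w) u, skew (φ v) w u]
  have zφ : ∀ u v w, c (φ u) v w = 0 := fun u v w ↦ by
    linarith [rel u v w, rel w u v]
  have zξφ : ∀ v w, c ξ (φ v) (φ w) = 0 := fun v w ↦ by
    have := cyc ξ (φ v) (φ w)
    rwa [zφ, zφ, add_zero, add_zero] at this
  have dec : ∀ v, v = -φ (φ v) + (inner ℝ v ξ : ℝ) • ξ := fun v ↦ by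
    rw [hφ.φ_φ]; abel
  have zξ : ∀ v w, c ξ v w = 0 := fun v w ↦ by
    rw [dec v, map_add, LinearMap.add_apply, map_smul, LinearMap.smul_apply, hξ, dec w, map_neg,
      LinearMap.neg_apply, map_add, map_neg, zξφ, map_smul, skew ξ (φ (φ v)) ξ, hξ]
    simp
  rw [dec u, map_add, LinearMap.add_apply, LinearMap.add_apply, map_neg, LinearMap.neg_apply,
    LinearMap.neg_apply, zφ, map_smul, LinearMap.smul_apply, LinearMap.smul_apply, zξ]
  simp

/-- The covariant derivatives `P u v = (∇_u φ) v` and `h u = ∇_u ξ` of an almost contact metric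
structure are determined by metric compatibility (`skew`), the exterior derivative of the
fundamental 2-form (`cyc`), the vanishing of the Nijenhuis torsion (`nij`) and the closedness of the
1-form (`hsymm`). -/
theorem eq_of_cyclic {P : V →ₗ[ℝ] V →ₗ[ℝ] V} {h : V →ₗ[ℝ] V} {α : ℝ}
    (skew : ∀ u v w, (inner ℝ (P u v) w : ℝ) = -inner ℝ (P u w) v)
    (cyc : ∀ u v w, (inner ℝ (P u v) w : ℝ) + inner ℝ (P v w) u + inner ℝ (P w u) v
      = 2 * α * (inner ℝ u ξ * inner ℝ (φ v) w + inner ℝ v ξ * inner ℝ (φ w) u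
        + inner ℝ w ξ * inner ℝ (φ u) v))
    (nij : ∀ u v, P (φ u) v - P (φ v) u + φ (P v u) - φ (P u v) = 0)
    (hP : ∀ u, P u ξ = -φ (h u)) (hsymm : ∀ u v, (inner ℝ (h u) v : ℝ) = inner ℝ u (h v))
    (hξ : ∀ u, (inner ℝ (h u) ξ : ℝ) = 0) :
    (∀ u v, P u v = α • ((inner ℝ (φ u) v : ℝ) • ξ - (inner ℝ v ξ : ℝ) • φ u))
      ∧ ∀ u, h u = α • (u - (inner ℝ u ξ : ℝ) • ξ) := by
  have hhξ : h ξ = 0 := by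
    refine ext_inner_right ℝ fun w ↦ ?_
    rw [hsymm, real_inner_comm, hξ, inner_zero_left]
  -- the difference of `⟪P u v, w⟫` and its expected value
  let c : V →ₗ[ℝ] V →ₗ[ℝ] V →ₗ[ℝ] ℝ := LinearMap.mk₂ ℝ
    (fun u v ↦ innerₗ V (P u v - α • ((inner ℝ (φ u) v : ℝ) • ξ - (inner ℝ v ξ : ℝ) • φ u)))
    (fun u u' v ↦ by
      refine (congrArg (innerₗ V) ?_).trans (map_add (innerₗ V) _ _)
      simp only [map_add, LinearMap.add_apply, inner_add_left]; module)
    (fun a u v ↦ by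
      refine (congrArg (innerₗ V) ?_).trans (map_smul (innerₗ V) _ _)
      simp only [map_smul, LinearMap.smul_apply, real_inner_smul_left]; module)
    (fun u v v' ↦ by
      refine (congrArg (innerₗ V) ?_).trans (map_add (innerₗ V) _ _)
      simp only [map_add, inner_add_right, inner_add_left]; module)
    (fun a u v ↦ by
      refine (congrArg (innerₗ V) ?_).trans (map_smul (innerₗ V) _ _)
      simp only [map_smul, real_inner_smul_left, real_inner_smul_right]; module)
  have hc : ∀ u v w, c u v w = inner ℝ (P u v) w
      - α * (inner ℝ (φ u) v * inner ℝ w ξ - inner ℝ v ξ * inner ℝ (φ u) w) := fun u v w ↦ by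
    simp only [c, LinearMap.mk₂_apply, innerₗ_apply_apply, inner_sub_left, real_inner_smul_left]
    rw [real_inner_comm w ξ]
  have hφφ : ∀ v w, (inner ℝ (φ (φ v)) w : ℝ) = -inner ℝ v w + inner ℝ v ξ * inner ℝ w ξ :=
    fun v w ↦ by
      rw [hφ.φ_φ, inner_add_left, inner_neg_left, real_inner_smul_left, real_inner_comm w ξ]
  have z := hφ.eq_zero_of_cyclic (c := c)
    (fun u v w ↦ by rw [hc, hc, skew]; ring)
    (fun u v w ↦ by
      simp only [hc]
      linarith [cyc u v w, congrArg (fun t ↦ α * t * inner ℝ w ξ) (hφ.inner_φ_swap u v),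
        congrArg (fun t ↦ α * t * inner ℝ u ξ) (hφ.inner_φ_swap v w),
        congrArg (fun t ↦ α * t * inner ℝ v ξ) (hφ.inner_φ_swap w u)])
    (fun u v w ↦ by
      have h1 := congrArg (fun t ↦ (inner ℝ t w : ℝ)) (nij u v)
      simp only [inner_add_left, inner_sub_left, inner_zero_left] at h1
      have h2 := hφ.skew (P v u) w
      have h3 := hφ.skew (P u v) w
      have h4 := hφ.skew (φ u) w
      have h5 := hφ.skew (φ v) w
      have h6 := hφ.inner_φ_ξ
      simp only [hc, hφφ, h2, h3, h4, h5, h6]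
      rw [hφ.inner_φ_swap v u, real_inner_comm u v]
      linarith)
    (fun w ↦ by
      rw [hc, hP, hhξ, hφ.φ_ξ, map_zero]
      simp)
  have hPm : ∀ u v, P u v = α • ((inner ℝ (φ u) v : ℝ) • ξ - (inner ℝ v ξ : ℝ) • φ u) :=
    fun u v ↦ by
      refine ext_inner_right ℝ fun w ↦ ?_
      have := z u v w
      rw [hc] at this
      rw [real_inner_smul_left, inner_sub_left, real_inner_smul_left, real_inner_smul_left,
        real_inner_comm w ξ]
      linarith
  refine ⟨hPm, fun u ↦ ?_⟩
  have h1 := congrArg φ ((hP u).symm.trans (hPm u ξ))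
  rw [map_neg, hφ.φ_φ, hξ, hφ.inner_φ_ξ, hφ.inner_ξ_ξ, zero_smul, one_smul, zero_sub, map_smul,
    map_neg, hφ.φ_φ] at h1
  rw [add_zero, neg_neg] at h1
  rw [h1]
  module

end IsAlmostContactMetric

end ContactAlgebra

/-! ### The Ricci and `*`-Ricci traces -/

section RicciAlgebra

variable {V : Type*} [NormedAddCommGroup V] [InnerProductSpace ℝ V]
  {φ : V →ₗ[ℝ] V} {ξ : V} {R : V → V → V → V} {α : ℝ} {ι : Type*} [Fintype ι]

/-- The Ricci trace `S(u, ξ) = -α² (n - 1) η(u)`. -/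
theorem sum_inner_curvature_ξ (b : OrthonormalBasis ι ℝ V)
    (hRξ : ∀ u v, R u v ξ = α ^ 2 • ((inner ℝ u ξ : ℝ) • v - (inner ℝ v ξ : ℝ) • u)) (u : V) :
    ∑ i, (inner ℝ (R (b i) u ξ) (b i) : ℝ) = -α ^ 2 * (Fintype.card ι - 1) * inner ℝ u ξ := by
  have h1 : ∀ i, (inner ℝ (R (b i) u ξ) (b i) : ℝ)
      = α ^ 2 * (inner ℝ u (b i) * inner ℝ (b i) ξ) - α ^ 2 * inner ℝ u ξ := fun i ↦ by
    rw [hRξ, real_inner_smul_left, inner_sub_left, real_inner_smul_left, real_inner_smul_left,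
      real_inner_self_eq_norm_sq, b.norm_eq_one]
    ring
  simp only [h1, Finset.sum_sub_distrib, ← Finset.mul_sum, b.sum_inner_mul_inner,
    Finset.sum_const, Finset.card_univ, nsmul_eq_mul]
  ring

/-- The `*`-Ricci trace in terms of the Ricci trace. The Bianchi identity and the pair symmetry
reduce `trace (φ ∘ R(u, φ v))` to twice the trace of `e ↦ -φ R(e, u)φ v`, where `φ` is then commuted
past the curvature operator. -/
theorem IsCurvatureTensor.sum_inner_φ_curvature (hR : IsCurvatureTensor R)
    (hφ : IsAlmostContactMetric φ ξ) (b : OrthonormalBasis ι ℝ V)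
    (hRξ : ∀ u v, R u v ξ = α ^ 2 • ((inner ℝ u ξ : ℝ) • v - (inner ℝ v ξ : ℝ) • u))
    (hRφ : ∀ u v w, R u v (φ w) = φ (R u v w) + α ^ 2 • ((inner ℝ v w : ℝ) • φ u
      - (inner ℝ u w : ℝ) • φ v + (inner ℝ u (φ w) : ℝ) • v - (inner ℝ v (φ w) : ℝ) • u))
    (u v : V) :
    (1 / 2) * ∑ i, (inner ℝ (φ (R u (φ v) (b i))) (b i) : ℝ)
      = ∑ i, (inner ℝ (R (b i) u v) (b i) : ℝ) + α ^ 2 * (Fintype.card ι - 2) * inner ℝ u v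
        + α ^ 2 * (inner ℝ u ξ * inner ℝ v ξ) := by
  have : FiniteDimensional ℝ V := b.toBasis.finiteDimensional_of_finite
  -- `e ↦ R(φv, e)u`, as a linear map
  let T : V →ₗ[ℝ] V :=
    { toFun := fun e ↦ R e (φ v) u
      map_add' := fun e e' ↦ hR.map_add_left ..
      map_smul' := fun a e ↦ hR.map_smul_left .. }
  have tr := LinearMap.trace_mul_comm ℝ φ T
  rw [LinearMap.trace_eq_sum_inner _ b, LinearMap.trace_eq_sum_inner _ b] at tr
  simp only [Module.End.mul_apply, T, LinearMap.coe_mk, AddHom.coe_mk] at tr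
  -- by the Bianchi identity and the pair symmetry the trace is twice that of `e ↦ -φ R(e, u)φv`
  have h1 : ∑ i, (inner ℝ (φ (R u (φ v) (b i))) (b i) : ℝ)
      = -2 * ∑ i, (inner ℝ (φ (R (b i) u (φ v))) (b i) : ℝ) := by
    have a1 : ∀ e, (inner ℝ (φ (R u (φ v) e)) e : ℝ)
        = inner ℝ e (φ (R e (φ v) u)) - inner ℝ (φ (R e u (φ v))) e := fun e ↦ by
      have hb := hR.bianchi u (φ v) e
      have : R u (φ v) e = R e (φ v) u - R e u (φ v) := by
        rw [hR.swap e (φ v) u, ← sub_eq_zero, ← hb]; abel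
      rw [this, map_sub, inner_sub_left, real_inner_comm e]
    have a2 : ∀ e, (inner ℝ e (R (φ e) (φ v) u) : ℝ) = -inner ℝ (φ (R e u (φ v))) e := fun e ↦ by
      rw [real_inner_comm, hR.swap, inner_neg_left, hR.pair_symm, hR.swap, inner_neg_left,
        hφ.skew, neg_neg]
    simp only [a1, Finset.sum_sub_distrib, tr, a2, Finset.sum_neg_distrib]
    ring
  have h2 : ∀ i, (inner ℝ (φ (R (b i) u (φ v))) (b i) : ℝ)
      = -inner ℝ (R (b i) u v) (b i) + inner ℝ v ξ * inner ℝ (R (b i) u ξ) (b i)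
        + α ^ 2 * (inner ℝ (φ u) (b i) * inner ℝ (b i) (φ v))
        - α ^ 2 * (inner ℝ u (b i) * inner ℝ (b i) (φ (φ v)))
        + α ^ 2 * inner ℝ u (φ (φ v)) := fun i ↦ by
    have a1 := hRφ (b i) u (φ v)
    have a2 : R (b i) u (φ (φ v)) = -R (b i) u v + (inner ℝ v ξ : ℝ) • R (b i) u ξ := by
      rw [hφ.φ_φ, hR.map_add_right, hR.map_smul_right, ← neg_one_smul ℝ v, hR.map_smul_right,
        neg_one_smul]
    have a3 : φ (R (b i) u (φ v)) = -R (b i) u v + (inner ℝ v ξ : ℝ) • R (b i) u ξ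
        - α ^ 2 • ((inner ℝ u (φ v) : ℝ) • φ (b i) - (inner ℝ (b i) (φ v) : ℝ) • φ u
          + (inner ℝ (b i) (φ (φ v)) : ℝ) • u - (inner ℝ u (φ (φ v)) : ℝ) • b i) := by
      rw [← a2, a1]; abel
    rw [a3]
    simp only [inner_add_left, inner_sub_left, inner_neg_left, real_inner_smul_left,
      hφ.inner_φ_self, real_inner_self_eq_norm_sq, b.norm_eq_one]
    ring
  have h3 : (inner ℝ u (φ (φ v)) : ℝ) = -inner ℝ u v + inner ℝ u ξ * inner ℝ v ξ := by
    rw [hφ.φ_φ, inner_add_right, inner_neg_right, real_inner_smul_right]; ring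
  have h4 : (inner ℝ (φ u) (φ v) : ℝ) = inner ℝ u v - inner ℝ u ξ * inner ℝ v ξ := by
    linarith [hφ.skew u (φ v)]
  rw [h1]
  simp only [h2, Finset.sum_add_distrib, Finset.sum_sub_distrib, ← Finset.mul_sum,
    b.sum_inner_mul_inner, Finset.sum_const, Finset.card_univ, nsmul_eq_mul,
    Finset.sum_neg_distrib, sum_inner_curvature_ξ b hRξ, h3, h4]
  ring

end RicciAlgebra

/-! ### The covariant derivative of the structure tensor -/

section Contact

variable {E : Type*} [NormedAddCommGroup E] [NormedSpace ℝ E] [FiniteDimensional ℝ E]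
  {H : Type*} [TopologicalSpace H] {I : ModelWithCorners ℝ E H}
  {M : Type*} [TopologicalSpace M] [ChartedSpace H M] [IsManifold I ∞ M]
  [RiemannianBundle (fun x : M ↦ TangentSpace I x)]
  [IsContMDiffRiemannianBundle I ∞ E (fun x : M ↦ TangentSpace I x)]

namespace AlmostContactMetricStructure

variable (A : AlmostContactMetricStructure I M)

theorem isAlmostContactMetric (x : M) :
    IsAlmostContactMetric (A.φ x : TangentSpace I x →ₗ[ℝ] TangentSpace I x) (A.ξ x) where
  φ_φ v := by
    rw [A.inner_ξ]
    exact A.φ_φ x v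
  inner_ξ_ξ := by rw [A.inner_ξ, A.η_ξ]
  φ_ξ := A.φ_ξ x
  skew v w := A.inner_φ_right x v w

variable {x : M}

theorem contMDiffAt_ξ {n : ℕ∞} : CMDiffAt n (T% A.ξ) x :=
  (A.contMDiff_ξ x).of_le (WithTop.coe_le_coe.2 le_top)

theorem mdifferentiableAt_ξ : MDiffAt (T% A.ξ) x :=
  (A.contMDiffAt_ξ (n := 1)).mdifferentiableAt one_ne_zero

variable {Y Z : Π x : M, TangentSpace I x}

theorem contMDiffAt_φ {n : ℕ∞} (hY : CMDiffAt n (T% Y) x) :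
    CMDiffAt n (T% (fun y ↦ A.φ y (Y y))) x :=
  ContMDiffAt.clm_bundle_apply ((A.contMDiff_φ x).of_le (WithTop.coe_le_coe.2 le_top)) hY

theorem mdifferentiableAt_φ (hY : MDiffAt (T% Y) x) : MDiffAt (T% (fun y ↦ A.φ y (Y y))) x :=
  MDifferentiableAt.clm_bundle_apply ((A.contMDiff_φ x).mdifferentiableAt (by simp)) hY

variable (cov : CovariantDerivative I E (TangentSpace I : M → Type _))

theorem tensorialAt_covDeriv_φ (x : M) :
    TensorialAt I E (fun Y : Π x : M, TangentSpace I x ↦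
      (cov (fun y ↦ A.φ y (Y y)) x - A.φ x ∘L cov Y x :
        TangentSpace I x →L[ℝ] TangentSpace I x)) x where
  smul {f Y} hf hY := by
    have h1 : (fun y ↦ A.φ y ((f • Y) y)) = f • fun y ↦ A.φ y (Y y) := by
      ext y; simp
    rw [h1, cov.isCovariantDerivativeOnUniv.leibniz (A.mdifferentiableAt_φ hY) hf,
      cov.isCovariantDerivativeOnUniv.leibniz hY hf]
    ext u
    simp
    module
  add {Y Y'} hY hY' := by
    have h1 : (fun y ↦ A.φ y ((Y + Y') y)) = (fun y ↦ A.φ y (Y y)) + fun y ↦ A.φ y (Y' y) := by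
      ext y; simp
    rw [h1, cov.isCovariantDerivativeOnUniv.add (A.mdifferentiableAt_φ hY)
      (A.mdifferentiableAt_φ hY'), cov.isCovariantDerivativeOnUniv.add hY hY']
    ext u
    simp
    module

/-- The covariant derivative `(∇_u φ) v = ∇_u (φ v) - φ (∇_u v)` of the structure tensor, as a
bilinear map in `u` and `v`. -/
def covDerivφ (x : M) :
    TangentSpace I x →ₗ[ℝ] TangentSpace I x →ₗ[ℝ] TangentSpace I x :=
  LinearMap.mk₂ ℝ (fun u v ↦ TensorialAt.mkHom _ x (A.tensorialAt_covDeriv_φ cov x) v u)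
    (fun _ _ _ ↦ by simp) (fun _ _ _ ↦ by simp) (fun _ _ _ ↦ by simp) (fun _ _ _ ↦ by simp)

theorem covDerivφ_apply (hY : MDiffAt (T% Y) x) (u : TangentSpace I x) :
    A.covDerivφ cov x u (Y x) = cov (fun y ↦ A.φ y (Y y)) x u - A.φ x (cov Y x u) := by
  rw [covDerivφ, LinearMap.mk₂_apply, TensorialAt.mkHom_apply _ hY]
  rfl

end AlmostContactMetricStructure

end Contact

/-! ### First derivatives on an `α`-cosymplectic manifold -/

section Cosymplectic

variable {E : Type*} [NormedAddCommGroup E] [NormedSpace ℝ E] [FiniteDimensional ℝ E]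
  {H : Type*} [TopologicalSpace H] {I : ModelWithCorners ℝ E H}
  {M : Type*} [TopologicalSpace M] [ChartedSpace H M] [IsManifold I ∞ M]
  [RiemannianBundle (fun x : M ↦ TangentSpace I x)]
  [IsContMDiffRiemannianBundle I ∞ E (fun x : M ↦ TangentSpace I x)]

namespace AlmostContactMetricStructure

variable {A : AlmostContactMetricStructure I M} {α : ℝ}
  {cov : CovariantDerivative I E (TangentSpace I : M → Type _)}
  {X Y Z : Π x : M, TangentSpace I x} {x : M}

theorem cov_φ_eq (hY : MDiffAt (T% Y) x) (u : TangentSpace I x) :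
    cov (fun y ↦ A.φ y (Y y)) x u = A.φ x (cov Y x u) + A.covDerivφ cov x u (Y x) := by
  rw [A.covDerivφ_apply cov hY]; abel

theorem covDerivφ_skew (h : IsMetric cov) (u v w : TangentSpace I x) :
    (inner ℝ (A.covDerivφ cov x u v) w : ℝ) = -inner ℝ (A.covDerivφ cov x u w) v := by
  have hV : MDiffAt (T% (extend E v)) x := mdifferentiableAt_extend ..
  have hW : MDiffAt (T% (extend E w)) x := mdifferentiableAt_extend ..
  have h1 := h x _ _ (A.mdifferentiableAt_φ hV) hW u
  have h2 := h x _ _ hV (A.mdifferentiableAt_φ hW) u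
  simp only [A.inner_φ_right, mvfderiv_fun_neg, _root_.neg_apply] at h2
  rw [h1, cov_φ_eq hV, cov_φ_eq hW] at h2
  simp only [extend_apply_self, inner_add_left, inner_add_right, A.inner_φ_right] at h2
  rw [real_inner_comm v]
  linarith

theorem mvfderiv_fundamentalForm (h : IsMetric cov) (hY : MDiffAt (T% Y) x)
    (hZ : MDiffAt (T% Z) x) (u : TangentSpace I x) :
    mvfderiv I (fun y ↦ A.fundamentalForm y (Y y) (Z y)) x u =
      inner ℝ (A.covDerivφ cov x u (Y x)) (Z x) + A.fundamentalForm x (cov Y x u) (Z x)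
        + A.fundamentalForm x (Y x) (cov Z x u) := by
  simp only [fundamentalForm]
  rw [h x _ _ (A.mdifferentiableAt_φ hY) hZ, cov_φ_eq hY, inner_add_left]
  ring

/-- `dΦ` is the cyclic sum of `g((∇_X φ) Y, Z)`. -/
theorem extDerivTwo_fundamentalForm (h : IsLeviCivita cov) (hX : MDiffAt (T% X) x)
    (hY : MDiffAt (T% Y) x) (hZ : MDiffAt (T% Z) x) :
    extDerivTwo I A.fundamentalForm X Y Z x =
      inner ℝ (A.covDerivφ cov x (X x) (Y x)) (Z x) + inner ℝ (A.covDerivφ cov x (Y x) (Z x)) (X x)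
        + inner ℝ (A.covDerivφ cov x (Z x) (X x)) (Y x) := by
  have sw : ∀ u v : TangentSpace I x, A.fundamentalForm x u v = -A.fundamentalForm x v u :=
    fun u v ↦ (A.isAlmostContactMetric x).inner_φ_swap u v
  have sb : ∀ u v w : TangentSpace I x, A.fundamentalForm x (u - v) w
      = A.fundamentalForm x u w - A.fundamentalForm x v w := fun u v w ↦ by
    simp [fundamentalForm, inner_sub_left]
  rw [extDerivTwo, mvfderiv_fundamentalForm h.1 hY hZ, mvfderiv_fundamentalForm h.1 hZ hX,
    mvfderiv_fundamentalForm h.1 hX hY, ← h.cov_sub_cov hX hY, ← h.cov_sub_cov hY hZ,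
    ← h.cov_sub_cov hZ hX]
  simp only [sb]
  rw [sw (Y x) (cov Z x (X x)), sw (Z x) (cov X x (Y x)), sw (X x) (cov Y x (Z x))]
  ring

/-- `dη` measures the asymmetry of `∇ξ`. -/
theorem extDerivOne_η (h : IsLeviCivita cov) (hX : MDiffAt (T% X) x) (hY : MDiffAt (T% Y) x) :
    extDerivOne I A.η X Y x =
      inner ℝ (Y x) (cov A.ξ x (X x)) - inner ℝ (X x) (cov A.ξ x (Y x)) := by
  have e : ∀ {Y : Π x : M, TangentSpace I x}, MDiffAt (T% Y) x → ∀ u,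
      mvfderiv I (fun y ↦ A.η y (Y y)) x u
        = A.η x (cov Y x u) + inner ℝ (Y x) (cov A.ξ x u) := fun hY u ↦ by
    simp only [← A.inner_ξ]
    exact h.1 x _ _ hY A.mdifferentiableAt_ξ u
  rw [extDerivOne, e hX, e hY, ← h.cov_sub_cov hX hY, map_sub]
  ring

theorem nijenhuis_eq (h : IsLeviCivita cov) (hX : MDiffAt (T% X) x) (hY : MDiffAt (T% Y) x) :
    nijenhuis I A.φ A.ξ A.η X Y x =
      A.covDerivφ cov x (A.φ x (X x)) (Y x) - A.covDerivφ cov x (A.φ x (Y x)) (X x)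
        + A.φ x (A.covDerivφ cov x (Y x) (X x)) - A.φ x (A.covDerivφ cov x (X x) (Y x))
        + extDerivOne I A.η X Y x • A.ξ x := by
  have hφX := A.mdifferentiableAt_φ hX
  have hφY := A.mdifferentiableAt_φ hY
  rw [nijenhuis, ← h.cov_sub_cov hφX hφY, ← h.cov_sub_cov hφX hY, ← h.cov_sub_cov hX hφY,
    ← h.cov_sub_cov hX hY]
  simp only [cov_φ_eq hX, cov_φ_eq hY, map_sub, map_add]
  abel

theorem inner_cov_ξ_ξ (h : IsMetric cov) (u : TangentSpace I x) :
    (inner ℝ (cov A.ξ x u) (A.ξ x) : ℝ) = 0 := by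
  have := h x A.ξ A.ξ A.mdifferentiableAt_ξ A.mdifferentiableAt_ξ u
  simp only [A.inner_ξ, A.η_ξ, mvfderiv_const, _root_.zero_apply] at this
  rw [real_inner_comm, A.inner_ξ] at this
  rw [A.inner_ξ]
  linarith

/-- On an `α`-cosymplectic manifold, `(∇_u φ) v = α (g(φ u, v) ξ - η(v) φ u)` and
`∇_u ξ = α (u - η(u) ξ)`. -/
theorem IsAlphaCosymplectic.covDerivφ_and_cov_ξ (hA : A.IsAlphaCosymplectic α)
    (h : IsLeviCivita cov) (x : M) :
    (∀ u v, A.covDerivφ cov x u v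
      = α • ((inner ℝ (A.φ x u) v : ℝ) • A.ξ x - (inner ℝ v (A.ξ x) : ℝ) • A.φ x u))
    ∧ ∀ u, cov A.ξ x u = α • (u - (inner ℝ u (A.ξ x) : ℝ) • A.ξ x) := by
  have hd : ∀ u : TangentSpace I x, MDiffAt (T% (extend E u)) x :=
    fun u ↦ mdifferentiableAt_extend ..
  refine (A.isAlmostContactMetric x).eq_of_cyclic
    (h := (cov A.ξ x : TangentSpace I x →ₗ[ℝ] TangentSpace I x))
    (covDerivφ_skew h.1) (fun u v w ↦ ?_) (fun u v ↦ ?_) (fun u ↦ ?_) (fun u v ↦ ?_)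
    (inner_cov_ξ_ξ h.1)
  · have := hA.dΦ_eq x _ _ _ (hd u) (hd v) (hd w)
    rw [extDerivTwo_fundamentalForm h (hd u) (hd v) (hd w)] at this
    simp only [extend_apply_self, fundamentalForm, ← A.inner_ξ] at this
    exact this
  · have := hA.normal x _ _ (hd u) (hd v)
    rw [nijenhuis_eq h (hd u) (hd v), hA.dη_eq x _ _ (hd u) (hd v), zero_smul, add_zero] at this
    simp only [extend_apply_self] at this
    exact this
  · rw [A.covDerivφ_apply cov A.mdifferentiableAt_ξ]
    simp only [A.φ_ξ]
    have : cov (fun _ ↦ 0) x = 0 := cov.isCovariantDerivativeOnUniv.zero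
    rw [this]
    simp
  · have := hA.dη_eq x _ _ (hd u) (hd v)
    rw [extDerivOne_η h (hd u) (hd v), sub_eq_zero] at this
    simp only [extend_apply_self] at this
    rw [real_inner_comm]
    exact this

theorem IsAlphaCosymplectic.cov_ξ (hA : A.IsAlphaCosymplectic α) (h : IsLeviCivita cov) (x : M)
    (u : TangentSpace I x) : cov A.ξ x u = α • (u - (inner ℝ u (A.ξ x) : ℝ) • A.ξ x) :=
  (hA.covDerivφ_and_cov_ξ h x).2 u

theorem IsAlphaCosymplectic.covDerivφ_eq (hA : A.IsAlphaCosymplectic α) (h : IsLeviCivita cov)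
    (x : M) (u v : TangentSpace I x) : A.covDerivφ cov x u v
      = α • ((inner ℝ (A.φ x u) v : ℝ) • A.ξ x - (inner ℝ v (A.ξ x) : ℝ) • A.φ x u) :=
  (hA.covDerivφ_and_cov_ξ h x).1 u v

end AlmostContactMetricStructure

end Cosymplectic

/-! ### Curvature of an `α`-cosymplectic manifold -/

section CosymplecticCurvature

variable {E : Type*} [NormedAddCommGroup E] [NormedSpace ℝ E] [FiniteDimensional ℝ E]
  {H : Type*} [TopologicalSpace H] {I : ModelWithCorners ℝ E H}
  {M : Type*} [TopologicalSpace M] [ChartedSpace H M] [IsManifold I ∞ M]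

section CovRules

variable (cov : CovariantDerivative I E (TangentSpace I : M → Type _))
  {X Y : Π x : M, TangentSpace I x} {f : M → ℝ} {x : M}

theorem cov_add (hX : MDiffAt (T% X) x) (hY : MDiffAt (T% Y) x) (u : TangentSpace I x) :
    cov (fun y ↦ X y + Y y) x u = cov X x u + cov Y x u :=
  DFunLike.congr_fun (cov.isCovariantDerivativeOnUniv.add hX hY) u

theorem cov_const_smul (c : ℝ) (hX : MDiffAt (T% X) x) (u : TangentSpace I x) :
    cov (fun y ↦ c • X y) x u = c • cov X x u :=
  DFunLike.congr_fun (cov.isCovariantDerivativeOnUniv.smul_const c hX) u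

theorem cov_smul (hf : MDiffAt f x) (hX : MDiffAt (T% X) x) (u : TangentSpace I x) :
    cov (fun y ↦ f y • X y) x u = f x • cov X x u + mvfderiv I f x u • X x := by
  have := DFunLike.congr_fun (cov.isCovariantDerivativeOnUniv.leibniz hX hf) u
  simpa using! this

theorem cov_sub (hX : MDiffAt (T% X) x) (hY : MDiffAt (T% Y) x) (u : TangentSpace I x) :
    cov (fun y ↦ X y - Y y) x u = cov X x u - cov Y x u := by
  have h1 : (fun y ↦ X y - Y y) = fun y ↦ X y + (-1 : ℝ) • Y y := by
    ext y; module
  have h2 : MDiffAt (T% (fun y ↦ (-1 : ℝ) • Y y)) x :=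
    MDifferentiableAt.smul_const_section (a := (-1 : ℝ)) hY
  rw [h1, cov_add cov hX h2, cov_const_smul cov _ hY]
  module

end CovRules

variable [RiemannianBundle (fun x : M ↦ TangentSpace I x)]
  [IsContMDiffRiemannianBundle I ∞ E (fun x : M ↦ TangentSpace I x)]

namespace AlmostContactMetricStructure

variable {A : AlmostContactMetricStructure I M} {α : ℝ}
  {cov : CovariantDerivative I E (TangentSpace I : M → Type _)}
  {X Y Z : Π x : M, TangentSpace I x} {x : M}

namespace IsAlphaCosymplectic

variable (hA : A.IsAlphaCosymplectic α) (h : IsLeviCivita cov)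
include hA h

theorem mvfderiv_inner_ξ (hY : MDiffAt (T% Y) x) (u : TangentSpace I x) :
    mvfderiv I (fun y ↦ (inner ℝ (Y y) (A.ξ y) : ℝ)) x u
      = inner ℝ (cov Y x u) (A.ξ x)
        + α * (inner ℝ (Y x) u - inner ℝ u (A.ξ x) * inner ℝ (Y x) (A.ξ x)) := by
  rw [h.1 x _ _ hY A.mdifferentiableAt_ξ, hA.cov_ξ h]
  simp only [inner_smul_right, inner_sub_right]

theorem cov_cov_ξ (hY : MDiffAt (T% Y) x) (u : TangentSpace I x) :
    cov (fun y ↦ cov A.ξ y (Y y)) x u = α • (cov Y x u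
      - ((inner ℝ (Y x) (A.ξ x) : ℝ) • α • (u - (inner ℝ u (A.ξ x) : ℝ) • A.ξ x)
        + ((inner ℝ (cov Y x u) (A.ξ x) : ℝ)
          + α * (inner ℝ (Y x) u - inner ℝ u (A.ξ x) * inner ℝ (Y x) (A.ξ x))) • A.ξ x)) := by
  have d1 : MDiffAt (fun y ↦ (inner ℝ (Y y) (A.ξ y) : ℝ)) x :=
    mdifferentiableAt_inner hY A.mdifferentiableAt_ξ
  have d2 : MDiffAt (T% (fun y ↦ (inner ℝ (Y y) (A.ξ y) : ℝ) • A.ξ y)) x :=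
    d1.smul_section A.mdifferentiableAt_ξ
  have d3 : MDiffAt (T% (fun y ↦ Y y - (inner ℝ (Y y) (A.ξ y) : ℝ) • A.ξ y)) x :=
    mdifferentiableAt_sub_section hY d2
  have e : (fun y ↦ cov A.ξ y (Y y)) = fun y ↦ α • (Y y - (inner ℝ (Y y) (A.ξ y) : ℝ) • A.ξ y) := by
    ext y
    rw [hA.cov_ξ h]
  rw [e, cov_const_smul cov _ d3, cov_sub cov hY d2, cov_smul cov d1 A.mdifferentiableAt_ξ,
    hA.mvfderiv_inner_ξ h hY, hA.cov_ξ h]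

/-- `R(u, v)ξ = α² (η(u) v - η(v) u)`. -/
theorem curvature_ξ [Nontrivial E] (x : M) (u v : TangentSpace I x) :
    curvature cov x u v (A.ξ x)
      = α ^ 2 • ((inner ℝ u (A.ξ x) : ℝ) • v - (inner ℝ v (A.ξ x) : ℝ) • u) := by
  have hd : ∀ u : TangentSpace I x, MDiffAt (T% (extend E u)) x :=
    fun u ↦ mdifferentiableAt_extend ..
  rw [h.curvature_apply A.contMDiffAt_ξ, curvatureField, hA.cov_cov_ξ h (hd v),
    hA.cov_cov_ξ h (hd u), hA.cov_ξ h, ← h.cov_sub_cov (hd u) (hd v)]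
  simp only [extend_apply_self, inner_sub_left]
  rw [real_inner_comm u v]
  module

theorem cov_φ (hY : MDiffAt (T% Y) x) (u : TangentSpace I x) :
    cov (fun y ↦ A.φ y (Y y)) x u = A.φ x (cov Y x u)
      + α • ((inner ℝ (A.φ x u) (Y x) : ℝ) • A.ξ x - (inner ℝ (Y x) (A.ξ x) : ℝ) • A.φ x u) := by
  rw [cov_φ_eq hY, hA.covDerivφ_eq h]

/-- `∇_u ∇_Y (φ Z)`, obtained by differentiating
`∇_Y (φ Z) = φ ∇_Y Z + α (g(φ Y, Z) ξ - η(Z) φ Y)`. -/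
theorem cov_cov_φ [Nontrivial E] (hY : CMDiffAt 2 (T% Y) x) (hZ : CMDiffAt 2 (T% Z) x)
    (u : TangentSpace I x) :
    cov (fun y ↦ cov (fun z ↦ A.φ z (Z z)) y (Y y)) x u =
      A.φ x (cov (fun y ↦ cov Z y (Y y)) x u)
      + α • ((inner ℝ (A.φ x u) (cov Z x (Y x)) : ℝ) • A.ξ x
          - (inner ℝ (cov Z x (Y x)) (A.ξ x) : ℝ) • A.φ x u)
      + α • ((inner ℝ (A.φ x (Y x)) (Z x) : ℝ) • α • (u - (inner ℝ u (A.ξ x) : ℝ) • A.ξ x)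
        + ((inner ℝ (A.φ x (cov Y x u)
          + α • ((inner ℝ (A.φ x u) (Y x) : ℝ) • A.ξ x
              - (inner ℝ (Y x) (A.ξ x) : ℝ) • A.φ x u)) (Z x) : ℝ)
            + inner ℝ (A.φ x (Y x)) (cov Z x u)) • A.ξ x
        - ((inner ℝ (Z x) (A.ξ x) : ℝ) • (A.φ x (cov Y x u)
          + α • ((inner ℝ (A.φ x u) (Y x) : ℝ) • A.ξ x - (inner ℝ (Y x) (A.ξ x) : ℝ) • A.φ x u))
          + ((inner ℝ (cov Z x u) (A.ξ x) : ℝ)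
            + α * (inner ℝ (Z x) u - inner ℝ u (A.ξ x) * inner ℝ (Z x) (A.ξ x)))
              • A.φ x (Y x))) := by
  have hYd := hY.mdifferentiableAt two_ne_zero
  have hZd := hZ.mdifferentiableAt two_ne_zero
  have hφY := A.mdifferentiableAt_φ hYd
  have hc := h.mdifferentiableAt_cov hY hZ
  have d1 : MDiffAt (fun y ↦ (inner ℝ (A.φ y (Y y)) (Z y) : ℝ)) x :=
    mdifferentiableAt_inner hφY hZd
  have d2 : MDiffAt (fun y ↦ (inner ℝ (Z y) (A.ξ y) : ℝ)) x :=
    mdifferentiableAt_inner hZd A.mdifferentiableAt_ξ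
  have d3 : MDiffAt (T% (fun y ↦ (inner ℝ (A.φ y (Y y)) (Z y) : ℝ) • A.ξ y)) x :=
    d1.smul_section A.mdifferentiableAt_ξ
  have d4 : MDiffAt (T% (fun y ↦ (inner ℝ (Z y) (A.ξ y) : ℝ) • A.φ y (Y y))) x :=
    d2.smul_section hφY
  have d5 : MDiffAt (T% (fun y ↦ (inner ℝ (A.φ y (Y y)) (Z y) : ℝ) • A.ξ y
      - (inner ℝ (Z y) (A.ξ y) : ℝ) • A.φ y (Y y))) x := mdifferentiableAt_sub_section d3 d4
  have d6 : MDiffAt (T% (fun y ↦ α • ((inner ℝ (A.φ y (Y y)) (Z y) : ℝ) • A.ξ y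
      - (inner ℝ (Z y) (A.ξ y) : ℝ) • A.φ y (Y y)))) x :=
    MDifferentiableAt.smul_const_section d5
  have d7 := A.mdifferentiableAt_φ hc
  have e : ∀ᶠ y in nhds x, cov (fun z ↦ A.φ z (Z z)) y (Y y)
      = A.φ y (cov Z y (Y y)) + α • ((inner ℝ (A.φ y (Y y)) (Z y) : ℝ) • A.ξ y
        - (inner ℝ (Z y) (A.ξ y) : ℝ) • A.φ y (Y y)) := by
    filter_upwards [eventually_contMDiffAt_section hZ] with y hy
    exact hA.cov_φ h (hy.mdifferentiableAt two_ne_zero) _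
  have d8 : MDiffAt (T% (fun y ↦ A.φ y (cov Z y (Y y)) + α • ((inner ℝ (A.φ y (Y y)) (Z y) : ℝ)
      • A.ξ y - (inner ℝ (Z y) (A.ξ y) : ℝ) • A.φ y (Y y)))) x :=
    mdifferentiableAt_add_section d7 d6
  rw [cov_congr cov d8 e, cov_add cov d7 d6,
    cov_const_smul cov _ d5, cov_sub cov d3 d4, cov_smul cov d1 A.mdifferentiableAt_ξ,
    cov_smul cov d2 hφY, hA.mvfderiv_inner_ξ h hZd, hA.cov_ξ h, h.1 x _ _ hφY hZd,
    hA.cov_φ h hYd, hA.cov_φ h hc]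

/-- The commutator of `φ` with the curvature operators, from differentiating the formula for `∇φ`
once more. -/
theorem curvature_φ [Nontrivial E] (x : M) (u v w : TangentSpace I x) :
    curvature cov x u v (A.φ x w) = A.φ x (curvature cov x u v w)
      + α ^ 2 • ((inner ℝ v w : ℝ) • A.φ x u - (inner ℝ u w : ℝ) • A.φ x v
        + (inner ℝ u (A.φ x w) : ℝ) • v - (inner ℝ v (A.φ x w) : ℝ) • u) := by
  have hd : ∀ u : TangentSpace I x, MDiffAt (T% (extend E u)) x :=
    fun u ↦ mdifferentiableAt_extend ..
  have h2 : ∀ u : TangentSpace I x, CMDiffAt 2 (T% (extend E u)) x :=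
    fun u ↦ contMDiffAt_extend ..
  have hφw := h.curvature_apply (A.contMDiffAt_φ (n := 2) (h2 w)) u v
  rw [extend_apply_self] at hφw
  have hsk : ∀ a b : TangentSpace I x, (inner ℝ a (A.φ x b) : ℝ) = -inner ℝ (A.φ x a) b :=
    A.inner_φ_right x
  have hsw : (inner ℝ (A.φ x v) u : ℝ) = -inner ℝ (A.φ x u) v :=
    (A.isAlmostContactMetric x).inner_φ_swap v u
  rw [hφw, curvature, curvatureField, curvatureField, hA.cov_cov_φ h (h2 v) (h2 w),
    hA.cov_cov_φ h (h2 u) (h2 w), hA.cov_φ h (hd w), ← h.cov_sub_cov (hd u) (hd v)]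
  simp only [extend_apply_self, map_sub, inner_sub_left, inner_add_left, real_inner_smul_left, hsk,
    hsw, real_inner_comm u w, real_inner_comm v w, real_inner_comm w (A.ξ x)]
  module

end IsAlphaCosymplectic

end AlmostContactMetricStructure

end CosymplecticCurvature

/-! ### The quarter-symmetric metric connection -/

section QuarterSymmetric

variable {E : Type*} [NormedAddCommGroup E] [NormedSpace ℝ E] [FiniteDimensional ℝ E]
  {H : Type*} [TopologicalSpace H] {I : ModelWithCorners ℝ E H}
  {M : Type*} [TopologicalSpace M] [ChartedSpace H M] [IsManifold I ∞ M]
  [RiemannianBundle (fun x : M ↦ TangentSpace I x)]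
  [IsContMDiffRiemannianBundle I ∞ E (fun x : M ↦ TangentSpace I x)]

namespace AlmostContactMetricStructure

variable {A : AlmostContactMetricStructure I M} {α : ℝ}
  {cov covT : CovariantDerivative I E (TangentSpace I : M → Type _)}
  {X Y Z : Π x : M, TangentSpace I x} {x : M}

/-- The quarter-symmetric metric connection is `∇_u Y - η(u) φ Y`. The difference of both sides is
skew in one pair of arguments, since both connections are metric, and symmetric in another, since
their torsions agree, so it vanishes. -/
theorem IsQuarterSymmetricMetric.cov_eq (hT : A.IsQuarterSymmetricMetric covT)
    (h : IsLeviCivita cov) (hY : MDiffAt (T% Y) x) (u : TangentSpace I x) :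
    covT Y x u = cov Y x u - (inner ℝ u (A.ξ x) : ℝ) • A.φ x (Y x) := by
  -- the difference of the two sides, as a tensor
  let D : TangentSpace I x → TangentSpace I x → TangentSpace I x := fun u v ↦
    covT.difference cov x v u + (inner ℝ u (A.ξ x) : ℝ) • A.φ x v
  have hD : ∀ {Y : Π x : M, TangentSpace I x}, MDiffAt (T% Y) x → ∀ u,
      D u (Y x) = covT Y x u - cov Y x u + (inner ℝ u (A.ξ x) : ℝ) • A.φ x (Y x) :=
    fun {Y} hY u ↦ by
      have := DFunLike.congr_fun (covT.isCovariantDerivativeOnUniv.difference_apply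
        cov.isCovariantDerivativeOnUniv (x := x) (σ := Y) trivial hY) u
      simp only [D, CovariantDerivative.difference]
      rw [this]
      rfl
  have hd : ∀ u : TangentSpace I x, MDiffAt (T% (extend E u)) x :=
    fun u ↦ mdifferentiableAt_extend ..
  have hDe : ∀ u v, D u v = covT (extend E v) x u - cov (extend E v) x u
      + (inner ℝ u (A.ξ x) : ℝ) • A.φ x v := fun u v ↦ by
    have := hD (hd v) u
    rwa [extend_apply_self] at this
  have skew : ∀ u v w, (inner ℝ (D u v) w : ℝ) = -inner ℝ (D u w) v := fun u v w ↦ by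
    have h1 := h.1 x _ _ (hd v) (hd w) u
    rw [hT.1 x _ _ (hd v) (hd w) u] at h1
    have h2 := (A.isAlmostContactMetric x).inner_φ_swap v w
    simp only [extend_apply_self, ContinuousLinearMap.coe_coe] at h1 h2
    simp only [hDe, inner_add_left, inner_sub_left, real_inner_smul_left]
    rw [h2]
    linarith [real_inner_comm v (covT (extend E w) x u), real_inner_comm v (cov (extend E w) x u)]
  have symm : ∀ u v, D u v = D v u := fun u v ↦ by
    have h1 := hT.2 x u v
    have h2 := covT.torsion_apply (hd u) (hd v)
    rw [← h.cov_sub_cov (hd u) (hd v)] at h2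
    simp only [extend_apply_self] at h2
    rw [h1, ← A.inner_ξ, ← A.inner_ξ] at h2
    rw [hDe, hDe, ← sub_eq_zero]
    rw [← sub_eq_zero] at h2
    rw [← neg_eq_zero, ← h2]
    abel
  have zero : D u (Y x) = 0 := by
    refine ext_inner_right ℝ fun w ↦ ?_
    rw [inner_zero_left]
    linarith [skew u (Y x) w, skew w u (Y x), skew (Y x) w u,
      congrArg (fun t ↦ (inner ℝ t w : ℝ)) (symm u (Y x)),
      congrArg (fun t ↦ (inner ℝ t (Y x) : ℝ)) (symm u w),
      congrArg (fun t ↦ (inner ℝ t u : ℝ)) (symm (Y x) w)]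
  rw [hD hY] at zero
  rw [← sub_eq_zero, ← zero]
  abel

/-- The curvature of the quarter-symmetric metric connection:
`R(u, v)w + η(u) (∇_v φ) w - η(v) (∇_u φ) w`. -/
theorem IsQuarterSymmetricMetric.curvature_eq [Nontrivial E]
    (hT : A.IsQuarterSymmetricMetric covT) (hA : A.IsAlphaCosymplectic α)
    (h : IsLeviCivita cov) (u v w : TangentSpace I x) :
    curvature covT x u v w = curvature cov x u v w
      + (inner ℝ u (A.ξ x) : ℝ) • A.covDerivφ cov x v w
      - (inner ℝ v (A.ξ x) : ℝ) • A.covDerivφ cov x u w := by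
  have hd : ∀ u : TangentSpace I x, MDiffAt (T% (extend E u)) x :=
    fun u ↦ mdifferentiableAt_extend ..
  have h2 : ∀ u : TangentSpace I x, CMDiffAt 2 (T% (extend E u)) x :=
    fun u ↦ contMDiffAt_extend ..
  have hφw := A.mdifferentiableAt_φ (hd w)
  have key : ∀ u v : TangentSpace I x,
      covT (fun y ↦ covT (extend E w) y (extend E v y)) x u =
        cov (fun y ↦ cov (extend E w) y (extend E v y)) x u
          - (mvfderiv I (fun y ↦ A.η y (extend E v y)) x u • A.φ x w
            + (inner ℝ v (A.ξ x) : ℝ) • (A.φ x (cov (extend E w) x u) + A.covDerivφ cov x u w))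
          - (inner ℝ u (A.ξ x) : ℝ) • A.φ x
            (cov (extend E w) x v - (inner ℝ v (A.ξ x) : ℝ) • A.φ x w) := by
    intro u v
    -- on fields near `x` the connection is `∇ - η ⊗ φ`, so it may be applied twice
    have hη : MDiffAt (fun y ↦ (inner ℝ (extend E v y) (A.ξ y) : ℝ)) x :=
      mdifferentiableAt_inner (hd v) A.mdifferentiableAt_ξ
    have d1 := h.mdifferentiableAt_cov (h2 v) (h2 w)
    have d2 : MDiffAt (T% (fun y ↦ (inner ℝ (extend E v y) (A.ξ y) : ℝ)
        • A.φ y (extend E w y))) x := hη.smul_section hφw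
    have d3 : MDiffAt (T% (fun y ↦ cov (extend E w) y (extend E v y)
        - (inner ℝ (extend E v y) (A.ξ y) : ℝ) • A.φ y (extend E w y))) x :=
      mdifferentiableAt_sub_section d1 d2
    have e : ∀ᶠ y in nhds x, covT (extend E w) y (extend E v y)
        = cov (extend E w) y (extend E v y)
          - (inner ℝ (extend E v y) (A.ξ y) : ℝ) • A.φ y (extend E w y) := by
      filter_upwards [eventually_contMDiffAt_section (h2 w)] with y hy
      exact hT.cov_eq h (hy.mdifferentiableAt two_ne_zero) _
    rw [cov_congr covT d3 e, hT.cov_eq h d3, cov_sub cov d1 d2, cov_smul cov hη hφw,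
      cov_φ_eq (hd w)]
    simp only [extend_apply_self, A.inner_ξ]
    module
  have hdη := hA.dη_eq x _ _ (hd u) (hd v)
  simp only [extDerivOne, extend_apply_self] at hdη
  rw [curvature, curvature, curvatureField, curvatureField, key, key, hT.cov_eq h (hd w)]
  simp only [extend_apply_self, map_sub, map_smul, A.inner_ξ]
  have hbr : A.η x (mlieBracket I (extend E u) (extend E v) x)
      = mvfderiv I (fun y ↦ A.η y (extend E v y)) x u
        - mvfderiv I (fun y ↦ A.η y (extend E u y)) x v := by linarith
  rw [hbr]
  module

end AlmostContactMetricStructure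

end QuarterSymmetric

/-! ### Traces and the soliton equation -/

section Traces

variable {E : Type*} [NormedAddCommGroup E] [NormedSpace ℝ E] [FiniteDimensional ℝ E]
  {H : Type*} [TopologicalSpace H] {I : ModelWithCorners ℝ E H}
  {M : Type*} [TopologicalSpace M] [ChartedSpace H M] [IsManifold I ∞ M]
  [RiemannianBundle (fun x : M ↦ TangentSpace I x)]
  [IsContMDiffRiemannianBundle I ∞ E (fun x : M ↦ TangentSpace I x)]

namespace AlmostContactMetricStructure

variable {A : AlmostContactMetricStructure I M} {α : ℝ}
  {cov covT : CovariantDerivative I E (TangentSpace I : M → Type _)} {x : M}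

theorem card_frame (I : ModelWithCorners ℝ E H) (x : M) :
    (Fintype.card (Fin (Module.finrank ℝ (TangentSpace I x))) : ℝ) = Module.finrank ℝ E := by
  rw [Fintype.card_fin]; rfl

theorem sum_inner_frame (x : M) :
    ∑ i, (inner ℝ (frame I x i) (frame I x i) : ℝ) = Module.finrank ℝ E := by
  simp only [real_inner_self_eq_norm_sq, (frame I x).norm_eq_one]
  rw [← card_frame I x]
  simp

variable (A) in
theorem sum_η_frame (x : M) : ∑ i, A.η x (frame I x i) * A.η x (frame I x i) = 1 := by
  have h1 := (frame I x).sum_inner_mul_inner (A.ξ x) (A.ξ x)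
  rw [A.inner_ξ, A.η_ξ] at h1
  rw [← h1]
  refine Finset.sum_congr rfl fun i _ ↦ ?_
  rw [real_inner_comm, A.inner_ξ]

section

variable (hA : A.IsAlphaCosymplectic α) (h : IsLeviCivita cov)
include hA h

theorem IsAlphaCosymplectic.divergence_ξ (x : M) :
    divergence cov A.ξ x = α * (Module.finrank ℝ E - 1) := by
  rw [divergence, LinearMap.trace_eq_sum_inner _ (frame I x)]
  have : ∀ i, (inner ℝ (frame I x i) ((cov A.ξ x : TangentSpace I x →ₗ[ℝ] TangentSpace I x)
      (frame I x i)) : ℝ) = α * (inner ℝ (frame I x i) (frame I x i)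
        - A.η x (frame I x i) * A.η x (frame I x i)) := fun i ↦ by
    rw [ContinuousLinearMap.coe_coe, hA.cov_ξ h, real_inner_smul_right, inner_sub_right,
      real_inner_smul_right, A.inner_ξ]
  simp only [this, ← Finset.mul_sum, Finset.sum_sub_distrib, sum_inner_frame, A.sum_η_frame]

theorem IsAlphaCosymplectic.ricci_ξ_ξ [Nontrivial E] (x : M) :
    ricci cov x (A.ξ x) (A.ξ x) = -α ^ 2 * (Module.finrank ℝ E - 1) := by
  rw [ricci, sum_inner_curvature_ξ (frame I x) (hA.curvature_ξ h x), card_frame, A.inner_ξ, A.η_ξ,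
    mul_one]

/-- The `*`-Ricci tensor of an `α`-cosymplectic manifold is `S + α² (n - 2) g + α² η ⊗ η`. -/
theorem IsAlphaCosymplectic.starRicci_eq [Nontrivial E] (v w : TangentSpace I x) :
    starRicci A.φ cov x v w = ricci cov x v w
      + α ^ 2 * (Module.finrank ℝ E - 2) * inner ℝ v w + α ^ 2 * (A.η x v * A.η x w) := by
  have := (h.isCurvatureTensor x).sum_inner_φ_curvature (A.isAlmostContactMetric x) (frame I x)
    (hA.curvature_ξ h x) (hA.curvature_φ h x) v w
  rw [card_frame, A.inner_ξ, A.inner_ξ] at this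
  exact this

theorem IsAlphaCosymplectic.starScalarCurvature_eq [Nontrivial E] (x : M) :
    starScalarCurvature A.φ cov x = scalarCurvature cov x
      + α ^ 2 * ((Module.finrank ℝ E : ℝ) - 1) ^ 2 := by
  simp only [starScalarCurvature, scalarCurvature, hA.starRicci_eq h, Finset.sum_add_distrib,
    ← Finset.mul_sum, sum_inner_frame, A.sum_η_frame]
  ring

variable (hT : A.IsQuarterSymmetricMetric covT)
include hT

theorem IsQuarterSymmetricMetric.lieDerivMetric_ξ (v w : TangentSpace I x) :
    lieDerivMetric covT A.ξ x v w = 2 * α * (inner ℝ v w - A.η x v * A.η x w) := by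
  have e : ∀ u, covT A.ξ x u = α • (u - (inner ℝ u (A.ξ x) : ℝ) • A.ξ x) := fun u ↦ by
    rw [hT.cov_eq h A.mdifferentiableAt_ξ, A.φ_ξ, smul_zero, sub_zero, hA.cov_ξ h]
  rw [lieDerivMetric, e, e]
  simp only [real_inner_smul_left, real_inner_smul_right, inner_sub_left, inner_sub_right,
    A.inner_ξ, real_inner_comm w (A.ξ x)]
  ring

/-- The Ricci tensors of the two connections differ by `α Φ`. -/
theorem IsQuarterSymmetricMetric.ricci_eq [Nontrivial E] (v w : TangentSpace I x) :
    ricci covT x v w = ricci cov x v w + α * A.fundamentalForm x v w := by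
  have hφ := A.isAlmostContactMetric x
  have e : ∀ i, (inner ℝ (curvature covT x (frame I x i) v w) (frame I x i) : ℝ)
      = inner ℝ (curvature cov x (frame I x i) v w) (frame I x i)
        + α * A.fundamentalForm x v w
          * (inner ℝ (A.ξ x) (frame I x i) * inner ℝ (frame I x i) (A.ξ x))
        - α * A.η x w * (inner ℝ (A.φ x v) (frame I x i) * inner ℝ (frame I x i) (A.ξ x))
        + α * A.η x v * (inner ℝ (A.ξ x) (frame I x i) * inner ℝ (frame I x i) (A.φ x w)) :=
    fun i ↦ by
      have h1 : (inner ℝ (A.φ x (frame I x i)) (frame I x i) : ℝ) = 0 := hφ.inner_φ_self _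
      rw [hT.curvature_eq hA h, hA.covDerivφ_eq h, hA.covDerivφ_eq h, A.inner_φ_right]
      simp only [inner_add_left, inner_sub_left, real_inner_smul_left, h1, A.inner_ξ,
        fundamentalForm]
      ring
  have h2 : (inner ℝ (A.φ x v) (A.ξ x) : ℝ) = 0 := hφ.inner_φ_ξ v
  have h3 : (inner ℝ (A.ξ x) (A.φ x w) : ℝ) = 0 := hφ.inner_ξ_φ w
  rw [ricci, ricci]
  simp only [e, Finset.sum_add_distrib, Finset.sum_sub_distrib, ← Finset.mul_sum,
    (frame I x).sum_inner_mul_inner, h2, h3, hφ.inner_ξ_ξ]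
  ring

theorem IsQuarterSymmetricMetric.ricci_self [Nontrivial E] (v : TangentSpace I x) :
    ricci covT x v v = ricci cov x v v := by
  have : A.fundamentalForm x v v = 0 := (A.isAlmostContactMetric x).inner_φ_self v
  rw [hT.ricci_eq hA h, this, mul_zero, add_zero]

theorem IsQuarterSymmetricMetric.scalarCurvature_eq [Nontrivial E] (x : M) :
    scalarCurvature covT x = scalarCurvature cov x := by
  simp only [scalarCurvature, hT.ricci_self hA h]

/-- The two connections have the same `*`-Ricci tensor: the correction to `φ ∘ R(v, φ w)` is a
multiple of `η ⊗ φ³ w`, and `η ∘ φ = 0`. -/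
theorem IsQuarterSymmetricMetric.starRicci_eq [Nontrivial E] (v w : TangentSpace I x) :
    starRicci A.φ covT x v w = starRicci A.φ cov x v w := by
  have hφ := A.isAlmostContactMetric x
  have h0 : ∀ u, (inner ℝ (A.φ x u) (A.ξ x) : ℝ) = 0 := hφ.inner_φ_ξ
  have e : ∀ i, (inner ℝ (A.φ x (curvature covT x v (A.φ x w) (frame I x i))) (frame I x i) : ℝ)
      = inner ℝ (A.φ x (curvature cov x v (A.φ x w) (frame I x i))) (frame I x i)
        - α * A.η x v * (inner ℝ (A.φ x (A.φ x (A.φ x w))) (frame I x i)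
          * inner ℝ (frame I x i) (A.ξ x)) := fun i ↦ by
    rw [hT.curvature_eq hA h, hA.covDerivφ_eq h, h0, zero_smul, sub_zero]
    simp only [map_add, map_smul, map_sub, A.φ_ξ, smul_zero, zero_sub, inner_add_left,
      real_inner_smul_left, inner_neg_left, A.inner_ξ]
    ring
  rw [starRicci, starRicci]
  simp only [e, Finset.sum_sub_distrib, ← Finset.mul_sum, (frame I x).sum_inner_mul_inner, h0]
  ring

theorem IsQuarterSymmetricMetric.starScalarCurvature_eq [Nontrivial E] (x : M) :
    starScalarCurvature A.φ covT x = starScalarCurvature A.φ cov x := by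
  simp only [starScalarCurvature, hT.starRicci_eq hA h]

/-- Both forms of the soliton equation give the same quadratic identity for the Levi-Civita
curvature. -/
theorem IsQuarterSymmetricMetric.soliton_quadratic [Nontrivial E] {ρ q Λ μ : ℝ}
    (hsol : A.IsStarEtaRicciYamabeSoliton covT ρ q Λ μ ∨
      A.IsStarEtaRicciYamabeSolitonRicciForm covT α ρ q Λ μ) (v : TangentSpace I x) :
    2 * ρ * ricci cov x v v
      + (2 * α + 2 * ρ * α ^ 2 * (Module.finrank ℝ E - 2) + 2 * Λ - q * scalarCurvature cov x
        - q * α ^ 2 * ((Module.finrank ℝ E : ℝ) - 1) ^ 2) * inner ℝ v v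
      + (2 * ρ * α ^ 2 + 2 * μ - 2 * α) * (A.η x v * A.η x v) = 0 := by
  rcases hsol with hs | hs
  · have := hs x v v
    rw [hT.lieDerivMetric_ξ hA h, hT.starRicci_eq hA h, hT.starScalarCurvature_eq hA h,
      hA.starRicci_eq h, hA.starScalarCurvature_eq h] at this
    linear_combination this
  · have := hs x v v
    rw [hT.lieDerivMetric_ξ hA h, hT.ricci_self hA h, hT.scalarCurvature_eq hA h] at this
    linear_combination this

end

end AlmostContactMetricStructure

end Traces

end AlphaCosymplectic

end

theorem corollary4p3 {n : ℕ} (hn : 1 < n)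
    {M : Type*} [TopologicalSpace M] [T2Space M]
    [ChartedSpace (EuclideanSpace ℝ (Fin n)) M] [IsManifold (𝓡 n) ∞ M]
    [RiemannianBundle (fun x : M ↦ TangentSpace (𝓡 n) x)]
    [IsContMDiffRiemannianBundle (𝓡 n) ∞ (EuclideanSpace ℝ (Fin n))
      (fun x : M ↦ TangentSpace (𝓡 n) x)]
    (A : AlphaCosymplectic.AlmostContactMetricStructure (𝓡 n) M) (α : ℝ)
    (hA : A.IsAlphaCosymplectic α)
    (nabla nablaT : CovariantDerivative (𝓡 n) (EuclideanSpace ℝ (Fin n))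
      (TangentSpace (𝓡 n) : M → Type _))
    (hnabla : AlphaCosymplectic.IsLeviCivita nabla)
    (hnablaT : A.IsQuarterSymmetricMetric nablaT)
    (ρ q Λ μ : ℝ)
    (hsol : A.IsStarEtaRicciYamabeSoliton nablaT ρ q Λ μ ∨
      A.IsStarEtaRicciYamabeSolitonRicciForm nablaT α ρ q Λ μ)
    (x : M) :
    Λ = q * AlphaCosymplectic.scalarCurvature nabla x / 2 + q * α ^ 2 * ((n : ℝ) - 1) ^ 2 / 2
        - α ^ 2 * ρ * ((n : ℝ) - 1)
        - (AlphaCosymplectic.divergence nabla A.ξ x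
            + ρ * AlphaCosymplectic.scalarCurvature nabla x) / ((n : ℝ) - 1)
      ∧ μ = α ^ 2 * ρ * ((n : ℝ) - 1)
        + (AlphaCosymplectic.divergence nabla A.ξ x
            + ρ * AlphaCosymplectic.scalarCurvature nabla x) / ((n : ℝ) - 1) := by
  have : Nontrivial (EuclideanSpace ℝ (Fin n)) :=
    Module.nontrivial_of_finrank_pos (R := ℝ) (by rw [finrank_euclideanSpace_fin]; omega)
  -- the quadratic identity at `ξ` and its trace are two linear equations for `Λ` and `μ`
  have hquad := fun v : TangentSpace (𝓡 n) x ↦ hnablaT.soliton_quadratic hA hnabla hsol v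
  have hξ := hquad (A.ξ x)
  have htr := Finset.sum_eq_zero fun (i : Fin (Module.finrank ℝ (TangentSpace (𝓡 n) x)))
    (_ : i ∈ Finset.univ) ↦ hquad (AlphaCosymplectic.frame (𝓡 n) x i)
  rw [hA.ricci_ξ_ξ hnabla, A.inner_ξ, A.η_ξ] at hξ
  simp only [Finset.sum_add_distrib, ← Finset.mul_sum, A.sum_η_frame,
    AlphaCosymplectic.AlmostContactMetricStructure.sum_inner_frame] at htr
  change 2 * ρ * AlphaCosymplectic.scalarCurvature nabla x + _ + _ = 0 at htr
  rw [hA.divergence_ξ hnabla]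
  rw [finrank_euclideanSpace_fin] at *
  have hn1 : (n : ℝ) - 1 ≠ 0 := by
    have : (1 : ℝ) < n := by exact_mod_cast hn
    linarith
  have hμ : μ = α ^ 2 * ρ * ((n : ℝ) - 1)
      + (α * (n - 1) + ρ * AlphaCosymplectic.scalarCurvature nabla x) / ((n : ℝ) - 1) := by
    rw [← sub_eq_iff_eq_add', eq_div_iff hn1]
    linear_combination (n * hξ - htr) / 2
  refine ⟨?_, hμ⟩
  linear_combination hξ / 2 - hμ
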